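/- Let $n,d\ge 1$ and let $v_1,\dots,v_n$ be variables with domain $[1,d]$. Let $P_{n,d}$ be the following logic program with atoms $b(v,i)$ (read $v\le i$), $r(v,l,u)$ (read $v\in[l,u]$), $sat$ and $violate$, where $v$ ranges over the variables and $[l,u]$ over the intervals contained in $[1,d]$: - $sat\leftarrow not\ violate$ and $violate\leftarrow not\ sat$ (reification of the all-different constraint); - $violate\leftarrow u-l+2\ \{r(v_1,l,u),\dots,r(v_n,l,u)\}$ (Hall-interval cardinality rules); - $\{b(v,1),\dots,b(v,d)\}\leftarrow$, $\ \bot\leftarrow b(v,i), not\ b(v,i+1)$ for $1\le i<d$, $\ \bot\leftarrow not\ b(v,d)$ (bound encoding); - $r(v,l,u)\leftarrow not\ b(v,l-1), b(v,u)$, $\ \bot\leftarrow r(v,l,u), b(v,l-1)$, $\ \bot\leftarrow r(v,l,u), not\ b(v,u)$ (link), where $b(v,0)$ is in no rule head and hence false. Unit-propagation is performed on the nogoods of the Clark completion of $P_{n,d}$ over its atoms and rule bodies, where a cardinality body $\beta=k\{a_1,\dots,a_m\}$ contributes the nogoods $\{F\beta\}\cup\{Ta: a\in I\}$ for $I\subseteq\{a_1,\dots,a_m\}$,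 $|I|=k$, and $\{T\beta\}\cup\{Fa: a\in I\}$ for $|I|=m-k+1$ (the nogood $\{T\beta\}$ if $k>m$). It fails if it derives complementary literals. A branch of the search tree is a finite sequence of decisions (signed atoms or bodies of $P_{n,d}$), each made at a node where unit-propagation has not failed and setting a literal that is not yet derived there. At a node, the domain $D(v)$ consists of the values $i\in[1,d]$ for which neither $Fb(v,i)$ nor $Tb(v,i-1)$ has been derived. All-different is bound consistent on domains $D$ if, for every variable $v$ and every $i\in\{\min D(v),\max D(v)\}$, there is an assignment of pairwise different values with $v=i$ and every other variable $w$ taking a value in $[\min D(w),\max D(w)]$. Then unit-propagation on $P_{n,d}$ enforces bound consistency on all-different at total cost $O(nd^2)$ down any branch of the search tree. Precisely, there is an absolute constant $C$ such that for all $n,d\ge1$ and every branch: 1. (Cost) The incremental counter-based propagator (one counter for each of the families of nogoods above, occurrence lists, unit cost per list entry visited, set-up included) detects failure, or else computes exactly the set of literals derived by unit-propagation, at all nodes of the branch, with at most $C\,nd^2$ elementary steps in total. 2. (Consistency) If $T\,sat$ is derived at the final node and unit-propagation does not fail there, then every $D(v)$ is a non-empty interval and all-different is bound consistent on $D$. 3.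 (Exactness) If the decisions of the branch are $T\,sat$ and literals on the atoms $b(v,i)$, let $D_0(v)$ be the set of values in $[1,d]$ allowed by the decisions on $v$. Unit-propagation fails at the final node if and only if there are no non-empty domains $E(v)\subseteq D_0(v)$ on which all-different is bound consistent; otherwise $D$ is the largest family of such domains. -/

import Mathlib

namespace BoundAllDiff

/-! ### Logic programs with choice rules and cardinality rules -/

/-- A signed variable: `⟨true, x⟩` is `x` (or `T x`), `⟨false, x⟩` is `not x` (or `F x`). -/
structure Lit (V : Type) where
  sign : Bool
  var : V
deriving DecidableEq

/-- The complementary literal. -/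
def Lit.neg {V : Type} (x : Lit V) : Lit V := ⟨!x.sign, x.var⟩

/-- A rule body `k {ℓ₁, …, ℓₘ}`: it holds iff at least `bound` of the literals hold. -/
structure Body (A : Type) where
  bound : ℕ
  lits : List (Lit A)
deriving DecidableEq

/-- The cardinality body `k {ℓ₁, …, ℓₘ}` of a set of literals. -/
def Body.card {A : Type} [DecidableEq A] (k : ℕ) (L : List (Lit A)) : Body A :=
  ⟨k, L.dedup⟩

/-- The ordinary body `ℓ₁, …, ℓₘ`: all literals have to hold. -/
def Body.conj {A : Type} [DecidableEq A] (L : List (Lit A)) : Body A :=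
  ⟨L.dedup.length, L.dedup⟩

/-- Rule heads: `⊥` (integrity constraint), an atom, or a choice `{h₁, …, hₖ}`. -/
inductive Head (A : Type) where
  | bot : Head A
  | atom (a : A) : Head A
  | choice (as : List A) : Head A
deriving DecidableEq

/-- The atoms in a head. -/
def Head.atoms {A : Type} : Head A → List A
  | .bot => []
  | .atom a => [a]
  | .choice as => as

/-- A rule `head ← body`. -/
structure Rule (A : Type) where
  head : Head A
  body : Body A
deriving DecidableEq

/-- A (ground) logic program. -/
abbrev Program (A : Type) := List (Rule A)

/-- The propositional variables an ASP solver assigns: the atoms and the bodies of a program. -/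
inductive Var (A : Type) where
  | atom (a : A) : Var A
  | body (β : Body A) : Var A
deriving DecidableEq

section Programs

variable {A : Type} [DecidableEq A]

/-- The bodies occurring in `P`. -/
def Program.bodies (P : Program A) : List (Body A) := (P.map Rule.body).dedup

/-- The atoms occurring in `P`. -/
def Program.atoms (P : Program A) : List A :=
  (P.flatMap fun r => r.head.atoms ++ r.body.lits.map Lit.var).dedup

/-- The solver variables of `P`. -/
def Program.vars (P : Program A) : List (Var A) :=
  P.atoms.map Var.atom ++ P.bodies.map Var.body

/-- The bodies of the rules that can support `a` (choice rules included). -/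
def Program.supports (P : Program A) (a : A) : List (Body A) :=
  ((P.filter fun r => decide (a ∈ r.head.atoms)).map Rule.body).dedup

/-- The bodies of the rules that force `a` (choice rules excluded). -/
def Program.forcing (P : Program A) (a : A) : List (Body A) :=
  ((P.filter fun r => decide (r.head = Head.atom a)).map Rule.body).dedup

/-! ### Nogoods of a program -/

/-- A family of nogoods in compact form: it is forbidden that `trigger` holds together with `bound`
(or more) of the literals `lits`. -/
structure NogoodGroup (V : Type) where
  trigger : Lit V
  bound : ℕ
  lits : List (Lit V)
deriving DecidableEq

/-- The nogoods that a group stands for: `{trigger} ∪ I` for the sets `I` of exactly `bound`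
literals from `lits`. -/
def NogoodGroup.nogoods {V : Type} [DecidableEq V] (g : NogoodGroup V) : Set (Finset (Lit V)) :=
  {δ | ∃ I : Finset (Lit V), I ⊆ g.lits.toFinset ∧ I.card = g.bound ∧ δ = insert g.trigger I}

/-- The assignment literal belonging to a program literal. -/
def Lit.lift (x : Lit A) : Lit (Var A) := ⟨x.sign, .atom x.var⟩

/-- The nogoods expressing `β ↔ (at least k of ℓ₁, …, ℓₘ)`:
`{F β} ∪ {T ℓ | ℓ ∈ I}` for `|I| = k`, and `{T β} ∪ {F ℓ | ℓ ∈ I}` for `|I| = m - k + 1`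
(the single nogood `{T β}` if `k > m`).  For an ordinary body these are the usual
`{F β, T ℓ₁, …, T ℓₘ}` and `{T β, F ℓᵢ}`. -/
def bodyGroups (β : Body A) : List (NogoodGroup (Var A)) :=
  [⟨⟨false, .body β⟩, β.bound, β.lits.map Lit.lift⟩,
   ⟨⟨true, .body β⟩, β.lits.length + 1 - β.bound, β.lits.map fun x => x.lift.neg⟩]

/-- The nogoods `{F a, T β}` for the bodies `β` forcing `a`, and `{T a, F β₁, …, F βₖ}` for
the bodies `β₁, …, βₖ` of all rules with `a` in the head. -/
def atomGroups (P : Program A) (a : A) : List (NogoodGroup (Var A)) :=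
  [⟨⟨false, .atom a⟩, 1, (P.forcing a).map fun β => ⟨true, .body β⟩⟩,
   ⟨⟨true, .atom a⟩, (P.supports a).length, (P.supports a).map fun β => ⟨false, .body β⟩⟩]

/-- The nogoods `{T β}` of the integrity constraints `⊥ ← β`. -/
def integrityGroups (P : Program A) : List (NogoodGroup (Var A)) :=
  (P.filter fun r => decide (r.head = Head.bot)).map fun r => ⟨⟨true, .body r.body⟩, 0, []⟩

/-- All nogoods of `P` (those of its Clark completion), in compact form. -/
def Program.groups (P : Program A) : List (NogoodGroup (Var A)) :=
  (P.bodies.flatMap bodyGroups ++ P.atoms.flatMap (atomGroups P) ++ integrityGroups P).dedup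

/-- All nogoods of `P`. -/
def Program.nogoods (P : Program A) : Set (Finset (Lit (Var A))) :=
  {δ | ∃ g ∈ P.groups, δ ∈ g.nogoods}

end Programs

/-! ### Unit-propagation -/

/-- `UP Δ S x`: unit-propagation on the nogoods `Δ` derives `x` from the literals `S`. -/
inductive UP {V : Type} (Δ : Set (Finset (Lit V))) (S : Set (Lit V)) : Lit V → Prop
  | given (x : Lit V) : x ∈ S → UP Δ S x
  | unit (δ : Finset (Lit V)) (x : Lit V) : δ ∈ Δ → x.neg ∈ δ →
      (∀ y ∈ δ, y ≠ x.neg → UP Δ S y) → UP Δ S x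

/-- Unit-propagation derives complementary literals. -/
def Conflict {V : Type} (Δ : Set (Finset (Lit V))) (S : Set (Lit V)) : Prop :=
  ∃ x, UP Δ S x ∧ UP Δ S x.neg

section Search

variable {A : Type} [DecidableEq A]

/-- The literals derived from the program `P` and the decisions `ds`. -/
def Derives (P : Program A) (ds : List (Lit (Var A))) (x : Lit (Var A)) : Prop :=
  UP P.nogoods {y | y ∈ ds} x

/-- Unit-propagation on `P` and the decisions `ds` fails. -/
def Fails (P : Program A) (ds : List (Lit (Var A))) : Prop :=
  Conflict P.nogoods {y | y ∈ ds}

/-- `ds` is the sequence of decisions on a path from the root of the search tree to a node: every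
decision is made at a node where unit-propagation has not failed, and makes a literal over the
variables of `P` true that is not true there yet (if it is false there, the new node fails). -/
inductive IsBranch (P : Program A) : List (Lit (Var A)) → Prop
  | root : IsBranch P []
  | decide (ds : List (Lit (Var A))) (x : Lit (Var A)) : IsBranch P ds → ¬ Fails P ds →
      x.var ∈ P.vars → ¬ Derives P ds x → IsBranch P (ds ++ [x])

end Search

/-! ### Incremental unit-propagation with a step count

The propagator keeps an assignment, one counter per group of nogoods (the number of processed true
literals among `lits`), a stack of assigned but unprocessed literals, and a stack of pending
traversals of lists.  Every transition inspects at most one list entry, makes a bounded number of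
look-ups and updates in arrays, and moves a bounded number of pointers; it costs one unit. -/

/-- A pending traversal of (the rest of) a list. -/
inductive Task (V : Type) where
  /-- root propagation: look for groups with `bound = 0` -/
  | setup (gs : List (NogoodGroup V)) : Task V
  /-- a literal in `lits` of these groups became true -/
  | bump (gs : List (NogoodGroup V)) : Task V
  /-- the trigger of these groups became true -/
  | fire (gs : List (NogoodGroup V)) : Task V
  /-- make those of the literals false that are still unassigned -/
  | falsify (xs : List (Lit V)) : Task V

/-- States of the propagator. -/
structure State (V : Type) where
  val : V → Option Bool
  count : NogoodGroup V → ℕ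
  stack : List (Lit V)
  todo : List (Task V)
  conflict : Bool

section Machine

variable {V : Type} [DecidableEq V]

/-- `x` is true in the current assignment. -/
def State.Holds (s : State V) (x : Lit V) : Prop := s.val x.var = some x.sign

instance State.decidableHolds (s : State V) (x : Lit V) : Decidable (s.Holds x) :=
  inferInstanceAs (Decidable (s.val x.var = some x.sign))

/-- Make `x` true and put it on the stack, unless it is true already; fail if it is false. -/
def State.assign (s : State V) (x : Lit V) : State V :=
  match s.val x.var with
  | none => { s with val := Function.update s.val x.var (some x.sign), stack := x :: s.stack }
  | some b => if b = x.sign then s else { s with conflict := true }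

/-- Put a task on the task stack. -/
def State.push (s : State V) (t : Task V) : State V := { s with todo := t :: s.todo }

/-- Root propagation of a group: a group with bound `0` makes its trigger false. -/
def State.setupGroup (s : State V) (g : NogoodGroup V) : State V :=
  if g.bound = 0 then s.assign g.trigger.neg else s

/-- A literal of `g` has become true: increase the counter.  If the bound is reached the trigger is
made false; if it is missed by one and the trigger is true, the remaining literals are. -/
def State.bumpGroup (s : State V) (g : NogoodGroup V) : State V :=
  let c := s.count g + 1
  let s' : State V := { s with count := Function.update s.count g c }
  if c = g.bound then s'.assign g.trigger.neg
  else if c + 1 = g.bound ∧ s.Holds g.trigger then s'.push (.falsify g.lits)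
  else s'

/-- The trigger of `g` has become true. -/
def State.fireGroup (s : State V) (g : NogoodGroup V) : State V :=
  if g.bound ≤ s.count g then { s with conflict := true }
  else if s.count g + 1 = g.bound then s.push (.falsify g.lits)
  else s

/-- Make `x` false if it is unassigned. -/
def State.falsifyLit (s : State V) (x : Lit V) : State V :=
  match s.val x.var with
  | none => s.assign x.neg
  | some _ => s

/-- The occurrence list of `x`: the groups of `G` with `x` among their `lits`. -/
def occurrences (G : List (NogoodGroup V)) (x : Lit V) : List (NogoodGroup V) :=
  G.filter fun g => decide (x ∈ g.lits)

/-- The groups of `G` triggered by `x`. -/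
def triggered (G : List (NogoodGroup V)) (x : Lit V) : List (NogoodGroup V) :=
  G.filter fun g => decide (g.trigger = x)

/-- One elementary step of the propagator on the groups `G`; `none` means that it has stopped, with
a conflict or because nothing is left to propagate. -/
def step (G : List (NogoodGroup V)) (s : State V) : Option (State V) :=
  if s.conflict then none else
  match s.todo with
  | [] =>
    match s.stack with
    | [] => none
    | x :: xs =>
      some { s with stack := xs, todo := [.bump (occurrences G x), .fire (triggered G x)] }
  | .setup [] :: ts => some { s with todo := ts }
  | .setup (g :: gs) :: ts => some (State.setupGroup { s with todo := .setup gs :: ts } g)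
  | .bump [] :: ts => some { s with todo := ts }
  | .bump (g :: gs) :: ts => some (State.bumpGroup { s with todo := .bump gs :: ts } g)
  | .fire [] :: ts => some { s with todo := ts }
  | .fire (g :: gs) :: ts => some (State.fireGroup { s with todo := .fire gs :: ts } g)
  | .falsify [] :: ts => some { s with todo := ts }
  | .falsify (x :: xs) :: ts => some (State.falsifyLit { s with todo := .falsify xs :: ts } x)

/-- `Exec G s t s'`: started in `s`, the propagator stops in `s'` after exactly `t` steps. -/
inductive Exec (G : List (NogoodGroup V)) : State V → ℕ → State V → Prop
  | done (s : State V) : step G s = none → Exec G s 0 s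
  | next (s s₁ s₂ : State V) (t : ℕ) : step G s = some s₁ → Exec G s₁ t s₂ → Exec G s (t + 1) s₂

/-- The state before the root propagation. -/
def State.start (G : List (NogoodGroup V)) : State V :=
  ⟨fun _ => none, fun _ => 0, [], [.setup G], false⟩

/-- The number of literal occurrences in `G`. -/
def size (G : List (NogoodGroup V)) : ℕ := (G.map fun g => g.lits.length + 1).sum

/-- `Run G ds t s`: going down the search tree along the decisions `ds`, propagating at the root and
after every decision, the propagator ends in state `s` at total cost `t`.  Building the counters and
occurrence lists is charged one unit per literal occurrence, a decision one unit. -/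
inductive Run (G : List (NogoodGroup V)) : List (Lit V) → ℕ → State V → Prop
  | root (t : ℕ) (s : State V) : Exec G (State.start G) t s → Run G [] (size G + t) s
  | decide (ds : List (Lit V)) (x : Lit V) (t t' : ℕ) (s s' : State V) : Run G ds t s →
      Exec G (s.assign x) t' s' → Run G (ds ++ [x]) (t + 1 + t') s'

end Machine

/-! ### Bound consistency -/

/-- A constraint on `n` integer variables, given by its relation `R`, is bound consistent on the
domains `D` iff the minimum and the maximum of every domain have a bound support. -/
def BoundConsistent {n : ℕ} (R : Set (Fin n → ℕ)) (D : Fin n → Set ℕ) : Prop :=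
  ∀ v i, IsLeast (D v) i ∨ IsGreatest (D v) i →
    ∃ f ∈ R, f v = i ∧ ∀ w, w ≠ v →
      ∃ lo hi, IsLeast (D w) lo ∧ IsGreatest (D w) hi ∧ lo ≤ f w ∧ f w ≤ hi

/-- The all-different constraint. -/
def allDifferent (n : ℕ) : Set (Fin n → ℕ) := {f | Function.Injective f}

/-! ### The encoding of all-different -/

/-- The atoms: `b v i` for `v ≤ i`, `r v l u` for `v ∈ [l, u]`, and the reification of the
all-different constraint. -/
inductive Atom (n : ℕ) where
  | b (v : Fin n) (i : ℕ) : Atom n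
  | r (v : Fin n) (l u : ℕ) : Atom n
  | sat : Atom n
  | violate : Atom n
deriving DecidableEq

/-- The program literal `a`. -/
abbrev pos {A : Type} (a : A) : Lit A := ⟨true, a⟩

/-- The program literal `not a`. -/
abbrev naf {A : Type} (a : A) : Lit A := ⟨false, a⟩

/-- The intervals `[l, u] ⊆ [1, d]`. -/
def intervals (d : ℕ) : List (ℕ × ℕ) :=
  (List.range' 1 d).flatMap fun l => (List.range' l (d + 1 - l)).map fun u => (l, u)

/-- Reification: `sat ← not violate` and `violate ← not sat`. -/
def reifyRules (n : ℕ) : Program (Atom n) :=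
  [⟨.atom .sat, .conj [naf .violate]⟩, ⟨.atom .violate, .conj [naf .sat]⟩]

/-- Hall intervals: `violate ← u-l+2 {r(v₁,l,u), …, r(vₙ,l,u)}`. -/
def hallRules (n d : ℕ) : Program (Atom n) :=
  (intervals d).map fun I =>
    ⟨.atom .violate, .card (I.2 - I.1 + 2) ((List.finRange n).map fun v => pos (.r v I.1 I.2))⟩

/-- The bound encoding of `v`: `{b(v,1), …, b(v,d)} ←`, then `⊥ ← b(v,i), not b(v,i+1)` for
`1 ≤ i < d`, and `⊥ ← not b(v,d)`. -/
def boundRules (n d : ℕ) : Program (Atom n) :=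
  (List.finRange n).flatMap fun v =>
    [⟨.choice ((List.range' 1 d).map fun i => .b v i), .conj []⟩] ++
    ((List.range' 1 (d - 1)).map fun i => ⟨.bot, .conj [pos (.b v i), naf (.b v (i + 1))]⟩) ++
    [⟨.bot, .conj [naf (.b v d)]⟩]

/-- The link between ranges and bounds: `r(v,l,u) ← not b(v,l-1), b(v,u)` and
`⊥ ← r(v,l,u), b(v,l-1)` and `⊥ ← r(v,l,u), not b(v,u)`.  The atom `b(v,0)` is in no
head, hence false. -/
def linkRules (n d : ℕ) : Program (Atom n) :=
  (List.finRange n).flatMap fun v => (intervals d).flatMap fun I =>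
    [⟨.atom (.r v I.1 I.2), .conj [naf (.b v (I.1 - 1)), pos (.b v I.2)]⟩,
     ⟨.bot, .conj [pos (.r v I.1 I.2), pos (.b v (I.1 - 1))]⟩,
     ⟨.bot, .conj [pos (.r v I.1 I.2), naf (.b v I.2)]⟩]

/-- The bound encoding of all-different on `n` variables with domain `[1, d]`. -/
def encoding (n d : ℕ) : Program (Atom n) :=
  reifyRules n ++ hallRules n d ++ boundRules n d ++ linkRules n d

/-- The assignment literal making an atom true or false. -/
abbrev atomLit {n : ℕ} (sign : Bool) (a : Atom n) : Lit (Var (Atom n)) := ⟨sign, .atom a⟩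

/-- The values of `v` that unit-propagation after the decisions `ds` leaves: `i ∈ [1, d]` is pruned
iff `v ≤ i` is derived to be false or `v ≤ i - 1` is derived to be true. -/
def domainAt (n d : ℕ) (ds : List (Lit (Var (Atom n)))) (v : Fin n) : Set ℕ :=
  {i | 1 ≤ i ∧ i ≤ d ∧ ¬ Derives (encoding n d) ds (atomLit false (.b v i)) ∧
    ¬ Derives (encoding n d) ds (atomLit true (.b v (i - 1)))}

/-- The domain of `v` before propagation: the values in `[1, d]` allowed by the decisions on the
bounds of `v`. -/
def givenDomain (n d : ℕ) (ds : List (Lit (Var (Atom n)))) (v : Fin n) : Set ℕ :=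
  {i | 1 ≤ i ∧ i ≤ d ∧ (∀ j, atomLit true (.b v j) ∈ ds → i ≤ j) ∧
    ∀ j, atomLit false (.b v j) ∈ ds → j < i}

/-- `E` arises from the domains `D` by pruning, without wiping out a domain, and all-different is
bound consistent on `E`. -/
def IsConsistentPruning {n : ℕ} (D E : Fin n → Set ℕ) : Prop :=
  (∀ v, E v ⊆ D v) ∧ (∀ v, (E v).Nonempty) ∧ BoundConsistent (allDifferent n) E

end BoundAllDiff

open BoundAllDiff

/-!
Unit-propagation on the encoding of all-different is cheap and enforces bound consistency, for three
independent reasons.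

*Cost.*  The propagator is analysed on an arbitrary list of groups of nogoods.  Its state satisfies
an `Invariant`: assigned literals are derivable, the counters count the processed true literals up to
increases that are still pending, and every consequence of a nogood is present or will be produced by
a pending traversal.  Hence, when it stops without a conflict, the assignment is closed under
unit-propagation (`Invariant.holds_of_up`).  The cost is bounded by a `State.potential`, which every
step lowers: a variable pays, when it is assigned, for the two lists of one of its literals, and a
counter pays for the one traversal it can start, when it comes within one of its bound.  Backtracking
does not occur on a branch, so the potential at the root, which is linear in the length of the
program, pays for the whole branch (`IsBranch.exists_run`).  The encoding has length `O(n d²)`.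

*Consistency.*  If propagation does not fail, the derived literals on `b(v,1), …, b(v,d)` are given
by two bounds `lo v ≤ hi v`.  Posting all-different makes `violate` false, so the Hall-interval rules
say that no interval contains more domains than it has values, and that an interval which contains
as many domains as it has values contains neither end of another domain.  This is Hall's condition
for the problem in which one variable is fixed to an end of its domain
(`exists_support_of_card_le`), since for interval domains the condition needs to be checked on
intervals only (`exists_injective_of_card_le`).

*Exactness.*  An injective assignment within the decided bounds is a model of the Clark completion
(`isCompletionModel_solutionAtoms`), and everything unit-propagation derives holds in all models.
If all-different is bound consistent on `E`, the supports of the ends of the sets `E v` are such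
assignments, so propagation neither fails nor prunes an element of `E v`.
-/

namespace BoundAllDiff

/-! ### Unit-propagation on groups of nogoods -/

@[simp] theorem Lit.neg_neg {V : Type} (x : Lit V) : x.neg.neg = x := by
  cases x; simp [Lit.neg]

@[simp] theorem Lit.var_neg {V : Type} (x : Lit V) : x.neg.var = x.var := rfl

theorem UP.mono {V : Type} {Δ : Set (Finset (Lit V))} {S T : Set (Lit V)} (h : S ⊆ T) {x : Lit V}
    (hx : UP Δ S x) : UP Δ T x := by
  induction hx with
  | given x hx => exact .given x (h hx)
  | unit δ x hδ hxδ _ ih => exact .unit δ x hδ hxδ ih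

section Groups

variable {V : Type} [DecidableEq V]

/-- The nogoods that the groups in `G` stand for. -/
def groupNogoods (G : List (NogoodGroup V)) : Set (Finset (Lit V)) :=
  {δ | ∃ g ∈ G, δ ∈ g.nogoods}

variable {G : List (NogoodGroup V)} {S : Set (Lit V)} {g : NogoodGroup V}

/-- If enough literals of a group are derived, so is the complement of its trigger. -/
theorem UP.trigger_neg (hg : g ∈ G) {I : Finset (Lit V)} (hI : I ⊆ g.lits.toFinset)
    (hc : g.bound ≤ I.card) (h : ∀ y ∈ I, UP (groupNogoods G) S y) :
    UP (groupNogoods G) S g.trigger.neg := by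
  obtain ⟨J, hJI, hJ⟩ := Finset.exists_subset_card_eq hc
  refine .unit (insert g.trigger J) _ ⟨g, hg, J, hJI.trans hI, hJ, rfl⟩ (by simp) ?_
  intro y hy hne
  rw [Lit.neg_neg] at hne
  exact h y (hJI ((Finset.mem_insert.1 hy).resolve_left hne))

/-- If the trigger and all but one of the required number of literals of a group are derived, so are
the complements of its other literals. -/
theorem UP.lit_neg (hg : g ∈ G) (ht : UP (groupNogoods G) S g.trigger) {I : Finset (Lit V)}
    (hI : I ⊆ g.lits.toFinset) (hc : g.bound = I.card + 1)
    (h : ∀ y ∈ I, UP (groupNogoods G) S y) {x : Lit V} (hx : x ∈ g.lits) (hxI : x ∉ I) :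
    UP (groupNogoods G) S x.neg := by
  refine .unit (insert g.trigger (insert x I)) _ ⟨g, hg, insert x I, ?_, ?_, rfl⟩ (by simp) ?_
  · exact Finset.insert_subset (List.mem_toFinset.2 hx) hI
  · rw [Finset.card_insert_of_notMem hxI, hc]
  · intro y hy hne
    rw [Lit.neg_neg] at hne
    rcases Finset.mem_insert.1 hy with rfl | hy
    · exact ht
    · exact h y ((Finset.mem_insert.1 hy).resolve_left hne)

end Groups

/-! ### Correctness of the propagator -/

section Correctness

variable {V : Type}

theorem State.Holds.not_neg {s : State V} {x : Lit V} (h : s.Holds x) : ¬ s.Holds x.neg := by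
  intro h'
  have : s.val x.var = some (!x.sign) := h'
  rw [show s.val x.var = some x.sign from h] at this
  simp at this

theorem State.Holds.val_ne {s : State V} {x : Lit V} (h : s.Holds x) : s.val x.var ≠ none := by
  rw [show s.val x.var = some x.sign from h]; simp

theorem State.holds_or_neg {s : State V} {x : Lit V} (h : s.val x.var ≠ none) :
    s.Holds x ∨ s.Holds x.neg := by
  obtain ⟨b, hb⟩ := Option.ne_none_iff_exists'.1 h
  by_cases hbs : b = x.sign
  · left; rw [State.Holds, hb, hbs]
  · right; rw [State.Holds, Lit.var_neg, hb]
    simpa [Lit.neg, Bool.eq_not] using hbs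

variable [DecidableEq V]

/-- The three ways in which an assignment can turn out. -/
theorem State.assign_cases (s : State V) (x : Lit V) :
    (s.Holds x ∧ s.assign x = s) ∨
    (s.Holds x.neg ∧ s.assign x = { s with conflict := true }) ∨
    (s.val x.var = none ∧ s.assign x =
      { s with val := Function.update s.val x.var (some x.sign), stack := x :: s.stack }) := by
  by_cases h : s.val x.var = none
  · right; right; refine ⟨h, ?_⟩
    unfold State.assign; split <;> simp_all
  · rcases State.holds_or_neg h with hx | hx
    · left; refine ⟨hx, ?_⟩
      have hx' : s.val x.var = some x.sign := hx
      unfold State.assign; split <;> simp_all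
    · right; left; refine ⟨hx, ?_⟩
      have hx' : s.val x.var = some (!x.sign) := hx
      unfold State.assign; split <;> simp_all

theorem State.holds_update {s : State V} {x : Lit V} (h : s.val x.var = none) (st : List (Lit V))
    (y : Lit V) :
    State.Holds { s with val := Function.update s.val x.var (some x.sign), stack := st } y ↔
      s.Holds y ∨ y = x := by
  unfold State.Holds
  by_cases hy : y.var = x.var
  · simp only [hy, Function.update_self, h, Option.some.injEq, reduceCtorEq, false_or]
    cases x; cases y; simp_all [eq_comm]
  · have : y ≠ x := fun h => hy (h ▸ rfl)
    simp [Function.update_of_ne hy, this]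

theorem State.Holds.assign {s : State V} {y : Lit V} (h : s.Holds y) (x : Lit V) :
    (s.assign x).Holds y := by
  rcases s.assign_cases x with ⟨_, he⟩ | ⟨_, he⟩ | ⟨hx, he⟩ <;> rw [he]
  · exact h
  · exact h
  · exact (State.holds_update hx _ y).2 (.inl h)

theorem State.holds_assign (s : State V) (x : Lit V) :
    (s.assign x).Holds x ∨ (s.assign x).conflict = true := by
  rcases s.assign_cases x with ⟨h, he⟩ | ⟨_, he⟩ | ⟨hx, he⟩ <;> rw [he]
  · exact .inl h
  · exact .inr rfl
  · exact .inl ((State.holds_update hx _ x).2 (.inr rfl))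

theorem State.assign_todo (s : State V) (x : Lit V) (td : List (Task V)) :
    State.assign { s with todo := td } x = { s.assign x with todo := td } := by
  unfold State.assign
  dsimp only
  split
  · rfl
  · split <;> rfl

theorem State.assign_count (s : State V) (x : Lit V) (c : NogoodGroup V → ℕ) :
    State.assign { s with count := c } x = { s.assign x with count := c } := by
  unfold State.assign
  dsimp only
  split
  · rfl
  · split <;> rfl

@[simp] theorem State.todo_assign (s : State V) (x : Lit V) : (s.assign x).todo = s.todo := by
  unfold State.assign
  split
  · rfl
  · split <;> rfl

@[simp] theorem State.count_assign (s : State V) (x : Lit V) : (s.assign x).count = s.count := by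
  unfold State.assign
  split
  · rfl
  · split <;> rfl

/-- How often the counter of `g` is still to be increased by pending traversals. -/
def Task.bumps (g : NogoodGroup V) : Task V → ℕ
  | .bump gs => gs.count g
  | _ => 0

/-- The facts that make carrying out a pending traversal sound: it concerns groups in `G`, groups
to be fired have a true trigger, and literals to be falsified belong to a group with a true trigger
and all but one of the required number of true literals. -/
def Task.Sound (G : List (NogoodGroup V)) (s : State V) : Task V → Prop
  | .setup gs => ∀ g ∈ gs, g ∈ G
  | .bump gs => ∀ g ∈ gs, g ∈ G
  | .fire gs => ∀ g ∈ gs, g ∈ G ∧ s.Holds g.trigger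
  | .falsify xs => ∃ g ∈ G, (∀ x ∈ xs, x ∈ g.lits) ∧ s.Holds g.trigger ∧
      ∃ J : Finset (Lit V), J ⊆ g.lits.toFinset ∧ (∀ y ∈ J, s.Holds y) ∧ g.bound = J.card + 1

theorem Task.Sound.mono {G : List (NogoodGroup V)} {s s' : State V}
    (h : ∀ x, s.Holds x → s'.Holds x) {t : Task V} (ht : t.Sound G s) : t.Sound G s' := by
  cases t with
  | setup gs => exact ht
  | bump gs => exact ht
  | fire gs => exact fun g hg => ⟨(ht g hg).1, h _ (ht g hg).2⟩
  | falsify xs =>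
    obtain ⟨g, hg, hxs, hgt, J, hJ, hJh, hc⟩ := ht
    exact ⟨g, hg, hxs, h _ hgt, J, hJ, fun y hy => h y (hJh y hy), hc⟩

/-- The true literals of `g` that have been taken from the stack. -/
def State.processed (s : State V) (g : NogoodGroup V) : Finset (Lit V) :=
  g.lits.toFinset.filter fun y => s.Holds y ∧ y ∉ s.stack

/-- The invariant of the propagator on the groups `G` for given literals `S`.  The last three fields
say that no consequence has been missed: each is present, or a pending traversal will yield it. -/
structure Invariant (G : List (NogoodGroup V)) (S : Set (Lit V)) (s : State V) : Prop where
  tasks : ∀ t ∈ s.todo, t.Sound G s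
  sound : ∀ x, s.Holds x → UP (groupNogoods G) S x
  fails : s.conflict = true → Conflict (groupNogoods G) S
  counts : ∀ g ∈ G, s.count g + (s.todo.map (Task.bumps g)).sum = (s.processed g).card
  stack_holds : ∀ x ∈ s.stack, s.Holds x
  stack_nodup : s.stack.Nodup
  given : s.conflict = false → ∀ x ∈ S, s.Holds x
  full : s.conflict = false → ∀ g ∈ G, g.bound ≤ s.count g → s.Holds g.trigger.neg ∨
    g.bound = 0 ∧ ∃ gs, Task.setup gs ∈ s.todo ∧ g ∈ gs
  near : s.conflict = false → ∀ g ∈ G, s.Holds g.trigger → g.trigger ∉ s.stack →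
    (∀ gs, Task.fire gs ∈ s.todo → g ∉ gs) → g.bound = s.count g + 1 →
    ∀ y ∈ g.lits, s.val y.var ≠ none ∨ ∃ xs, Task.falsify xs ∈ s.todo ∧ y ∈ xs

namespace Invariant

variable {G : List (NogoodGroup V)} {S : Set (Lit V)} {s : State V}

theorem set_conflict (h : Invariant G S s) (hc : Conflict (groupNogoods G) S) :
    Invariant G S { s with conflict := true } where
  tasks := h.tasks
  sound := h.sound
  fails _ := hc
  counts := h.counts
  stack_holds := h.stack_holds
  stack_nodup := h.stack_nodup
  given h := by simp at h
  full h := by simp at h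
  near h := by simp at h

/-- A decision: assigning `x` keeps the invariant once `x` is among the given literals. -/
theorem insert_of_assign (h : Invariant G S s) (x : Lit V) :
    Invariant G (insert x S) (s.assign x) := by
  have hmono : ∀ {y}, UP (groupNogoods G) S y → UP (groupNogoods G) (insert x S) y :=
    fun hy => hy.mono (Set.subset_insert x S)
  have hxS : UP (groupNogoods G) (insert x S) x := .given x (Set.mem_insert x S)
  have hg := s.holds_assign x
  rcases s.assign_cases x with ⟨hx, he⟩ | ⟨hx, he⟩ | ⟨hx, he⟩ <;> rw [he] at hg ⊢
  · exact
    { h with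
      sound := fun y hy => hmono (h.sound y hy)
      fails := fun hc => by
        obtain ⟨y, h1, h2⟩ := h.fails hc
        exact ⟨y, hmono h1, hmono h2⟩
      given := fun hc y hy => by
        rcases hy with rfl | hy
        · exact hx
        · exact h.given hc y hy }
  · exact
    { tasks := h.tasks
      sound := fun y hy => hmono (h.sound y hy)
      fails := fun _ => ⟨x, hxS, hmono (h.sound _ hx)⟩
      counts := h.counts
      stack_holds := h.stack_holds
      stack_nodup := h.stack_nodup
      given := fun h => by simp at h
      full := fun h => by simp at h
      near := fun h => by simp at h }
  · have hup := State.holds_update hx (x :: s.stack)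
    have hnx : ¬ s.Holds x := fun h => h.val_ne hx
    exact
    { tasks := fun t ht => (h.tasks t ht).mono fun y hy => (hup y).2 (.inl hy)
      sound := fun y hy => by
        rcases (hup y).1 hy with hy | rfl
        · exact hmono (h.sound y hy)
        · exact hxS
      fails := fun hc => by
        obtain ⟨y, h1, h2⟩ := h.fails hc
        exact ⟨y, hmono h1, hmono h2⟩
      counts := fun g hg => by
        refine (h.counts g hg).trans (congrArg Finset.card ?_)
        ext y
        simp only [State.processed, Finset.mem_filter, hup, List.mem_cons]
        constructor
        · rintro ⟨h1, h2, h3⟩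
          exact ⟨h1, .inl h2, by rintro (rfl | h4) <;> contradiction⟩
        · rintro ⟨h1, h2, h3⟩
          exact ⟨h1, h2.resolve_right fun h => h3 (.inl h), fun h => h3 (.inr h)⟩
      stack_holds := fun y hy => by
        rcases List.mem_cons.1 hy with rfl | hy
        · exact (hup y).2 (.inr rfl)
        · exact (hup y).2 (.inl (h.stack_holds y hy))
      stack_nodup := List.nodup_cons.2 ⟨fun hm => hnx (h.stack_holds x hm), h.stack_nodup⟩
      given := fun hc y hy => by
        rcases hy with rfl | hy
        · exact (hup y).2 (.inr rfl)
        · exact (hup y).2 (.inl (h.given hc y hy))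
      full := fun hc g hg hb => by
        rcases h.full hc g hg hb with h1 | h1
        · exact .inl ((hup _).2 (.inl h1))
        · exact .inr h1
      near := fun hc g hg ht hst hf hb y hy => by
        have ht' := ((hup _).1 ht).resolve_right fun h => hst (h ▸ List.mem_cons_self)
        rcases h.near hc g hg ht' (fun hm => hst (List.mem_cons_of_mem _ hm)) hf hb y hy with h1 | h1
        · left
          dsimp only
          by_cases hyx : y.var = x.var
          · simp [hyx]
          · rwa [Function.update_of_ne hyx]
        · exact .inr h1 }

/-- Derived literals may be assigned: they count as given without changing what is derivable. -/
theorem assign (h : Invariant G S s) {x : Lit V} (hx : UP (groupNogoods G) S x) :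
    Invariant G S (s.assign x) := by
  have hcut : ∀ {y}, UP (groupNogoods G) (insert x S) y → UP (groupNogoods G) S y := by
    intro y hy
    induction hy with
    | given y hy => exact hy.elim (fun h => h ▸ hx) fun h => .given y h
    | unit δ y hδ hyδ _ ih => exact .unit δ y hδ hyδ ih
  have h' := h.insert_of_assign x
  exact
  { h' with
    sound := fun y hy => hcut (h'.sound y hy)
    fails := fun hc => by
      obtain ⟨y, h1, h2⟩ := h'.fails hc
      exact ⟨y, hcut h1, hcut h2⟩
    given := fun hc y hy => h'.given hc y (Set.mem_insert_of_mem _ hy) }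

/-- Changes of the task list that do not affect the counters. -/
theorem set_todo (h : Invariant G S s) (td : List (Task V)) (ht : ∀ t ∈ td, t.Sound G s)
    (hb : ∀ g, (td.map (Task.bumps g)).sum = (s.todo.map (Task.bumps g)).sum)
    (hs : s.conflict = false → ∀ g ∈ G, g.bound = 0 → (∃ gs, Task.setup gs ∈ s.todo ∧ g ∈ gs) →
      s.Holds g.trigger.neg ∨ ∃ gs, Task.setup gs ∈ td ∧ g ∈ gs)
    (hf : s.conflict = false → ∀ g ∈ G, g.bound = s.count g + 1 →
      (∃ gs, Task.fire gs ∈ s.todo ∧ g ∈ gs) → (∃ gs, Task.fire gs ∈ td ∧ g ∈ gs) ∨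
        ∃ xs, Task.falsify xs ∈ td ∧ ∀ y ∈ g.lits, y ∈ xs)
    (hx : s.conflict = false → ∀ y xs, Task.falsify xs ∈ s.todo → y ∈ xs → s.val y.var ≠ none ∨
      ∃ xs, Task.falsify xs ∈ td ∧ y ∈ xs) :
    Invariant G S { s with todo := td } where
  tasks := ht
  sound := h.sound
  fails := h.fails
  counts g hg := (congrArg _ (hb g)).trans (h.counts g hg)
  stack_holds := h.stack_holds
  stack_nodup := h.stack_nodup
  given := h.given
  full hc g hg hgb := by
    rcases h.full hc g hg hgb with h1 | ⟨h1, h2⟩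
    · exact .inl h1
    · exact (hs hc g hg h1 h2).imp id fun h => ⟨h1, h⟩
  near hc g hg hgt hst hgf hgb y hy := by
    by_cases hfire : ∃ gs, Task.fire gs ∈ s.todo ∧ g ∈ gs
    · rcases hf hc g hg hgb hfire with ⟨gs, h1, h2⟩ | ⟨xs, h1, h2⟩
      · exact absurd h2 (hgf gs h1)
      · exact .inr ⟨xs, h1, h2 y hy⟩
    · push Not at hfire
      rcases h.near hc g hg hgt hst hfire hgb y hy with h1 | ⟨xs, h1, h2⟩
      · exact .inl h1
      · exact hx hc y xs h1 h2

theorem start (G : List (NogoodGroup V)) : Invariant G ∅ (State.start G) where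
  tasks := by simp [State.start, Task.Sound]
  sound x hx := by simp [State.start, State.Holds] at hx
  fails h := by simp [State.start] at h
  counts g hg := by simp [State.start, State.processed, State.Holds, Task.bumps]
  stack_holds := by simp [State.start]
  stack_nodup := by simp [State.start]
  given := by simp
  full _ g hg hb := .inr ⟨Nat.le_zero.1 hb, G, by simp [State.start], hg⟩
  near _ g hg ht := by simp [State.start, State.Holds] at ht

theorem pop (h : Invariant G S s) (hG : G.Nodup) (htd : s.todo = []) {x : Lit V} {xs : List (Lit V)}
    (hst : s.stack = x :: xs) : Invariant G S
      { s with stack := xs, todo := [.bump (occurrences G x), .fire (triggered G x)] } where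
  tasks := by
    have hx := h.stack_holds x (by simp [hst])
    intro t ht
    simp only [List.mem_cons, List.not_mem_nil, or_false] at ht
    rcases ht with rfl | rfl
    · exact fun g hg => (List.mem_filter.1 hg).1
    · intro g hg
      obtain ⟨h1, h2⟩ := List.mem_filter.1 hg
      refine ⟨h1, ?_⟩
      rw [of_decide_eq_true h2]; exact hx
  sound := h.sound
  fails := h.fails
  counts g hg := by
    have hx := h.stack_holds x (by simp [hst])
    have hnd := h.stack_nodup
    rw [hst, List.nodup_cons] at hnd
    have hc := h.counts g hg
    simp only [htd, List.map_nil, List.sum_nil, Nat.add_zero] at hc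
    simp only [List.map_cons, List.map_nil, List.sum_cons, List.sum_nil, Nat.add_zero, Task.bumps,
      hc]
    by_cases hxg : x ∈ g.lits
    · have : (occurrences G x).count g = 1 :=
        List.count_eq_one_of_mem (hG.filter _) (List.mem_filter.2 ⟨hg, by simpa using hxg⟩)
      rw [this]
      have he : State.processed
          { s with stack := xs, todo := [.bump (occurrences G x), .fire (triggered G x)] } g =
          insert x (s.processed g) := by
        ext y
        simp only [State.processed, Finset.mem_filter, Finset.mem_insert, hst, List.mem_cons,
          List.mem_toFinset]
        constructor
        · rintro ⟨h1, h2, h3⟩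
          by_cases hyx : y = x
          · exact .inl hyx
          · exact .inr ⟨h1, h2, by simp [hyx, h3]⟩
        · rintro (rfl | ⟨h1, h2, h3⟩)
          · exact ⟨hxg, hx, hnd.1⟩
          · exact ⟨h1, h2, fun h => h3 (.inr h)⟩
      rw [he, Finset.card_insert_of_notMem]
      simp [State.processed, hst]
    · have : (occurrences G x).count g = 0 :=
        List.count_eq_zero_of_not_mem fun hm => hxg (by simpa using (List.mem_filter.1 hm).2)
      rw [this, Nat.add_zero]
      congr 1
      ext y
      simp only [State.processed, Finset.mem_filter, hst, List.mem_cons, List.mem_toFinset]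
      constructor
      · rintro ⟨h1, h2, h3⟩
        exact ⟨h1, h2, fun h => h3 (.inr h)⟩
      · rintro ⟨h1, h2, h3⟩
        refine ⟨h1, h2, ?_⟩
        rintro (rfl | h4) <;> contradiction
  stack_holds y hy := h.stack_holds y (by rw [hst]; exact List.mem_cons_of_mem _ hy)
  stack_nodup := by
    have hnd := h.stack_nodup
    rw [hst, List.nodup_cons] at hnd
    exact hnd.2
  given := h.given
  full hc g hg hb := by
    rcases h.full hc g hg hb with h1 | ⟨_, gs, h2, _⟩
    · exact .inl h1
    · rw [htd] at h2; simp at h2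
  near hc g hg hgt hgst hgf hgb y hy := by
    have hne : g.trigger ≠ x := fun he =>
      hgf (triggered G x) (by simp) (List.mem_filter.2 ⟨hg, by simpa using he⟩)
    rcases h.near hc g hg hgt (by rw [hst]; simpa [hne] using hgst) (by simp [htd]) hgb y hy
      with h1 | ⟨ys, h1, _⟩
    · exact .inl h1
    · rw [htd] at h1; simp at h1

/-- Increasing a counter on behalf of a pending traversal.  `pre` may hold the traversal that
falsifies the remaining literals of the group. -/
theorem tick (h : Invariant G S s) {g : NogoodGroup V} {gs : List (NogoodGroup V)}
    {ts : List (Task V)} (htd : s.todo = .bump (g :: gs) :: ts) (pre : List (Task V))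
    (hpre : pre = [] ∨ pre = [.falsify g.lits] ∧ g.bound = s.count g + 2 ∧ s.Holds g.trigger)
    (hfull : s.conflict = false → g.bound = s.count g + 1 → s.Holds g.trigger.neg)
    (hnear : g.bound = s.count g + 2 → s.Holds g.trigger → pre ≠ []) :
    Invariant G S { s with
      count := Function.update s.count g (s.count g + 1), todo := pre ++ .bump gs :: ts } where
  tasks := by
    have hg : g ∈ G := h.tasks (.bump (g :: gs)) (by simp [htd]) g (by simp)
    intro t ht
    simp only [List.mem_append, List.mem_cons] at ht
    rcases ht with ht | rfl | ht
    · rcases hpre with rfl | ⟨rfl, hb, hgt⟩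
      · simp at ht
      · obtain rfl := List.mem_singleton.1 ht
        have hc := h.counts g hg
        rw [htd] at hc
        simp only [List.map_cons, List.sum_cons, Task.bumps, List.count_cons_self] at hc
        obtain ⟨J, hJ, hJc⟩ := Finset.exists_subset_card_eq
          (show g.bound - 1 ≤ (s.processed g).card by omega)
        refine ⟨g, hg, fun x hx => hx, hgt, J, hJ.trans (Finset.filter_subset _ _), ?_, by omega⟩
        exact fun y hy => (Finset.mem_filter.1 (hJ hy)).2.1
    · exact fun g' hg' => h.tasks (.bump (g :: gs)) (by simp [htd]) g' (by simp [hg'])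
    · exact h.tasks t (by simp [htd, ht])
  sound := h.sound
  fails := h.fails
  counts g' hg' := by
    have hc := h.counts g' hg'
    have hp : (pre.map (Task.bumps g')).sum = 0 := by
      rcases hpre with rfl | ⟨rfl, _⟩ <;> simp [Task.bumps]
    rw [htd] at hc
    refine Eq.trans ?_ hc
    simp only [List.map_append, List.sum_append, List.map_cons, List.sum_cons, hp, Task.bumps]
    by_cases he : g' = g
    · subst he
      simp only [Function.update_self, List.count_cons_self]
      omega
    · rw [Function.update_of_ne he, List.count_cons_of_ne (Ne.symm he)]
      omega
  stack_holds := h.stack_holds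
  stack_nodup := h.stack_nodup
  given := h.given
  full hc g' hg' hb := by
    by_cases he : g' = g
    · subst he
      simp only [Function.update_self] at hb
      by_cases hb' : g'.bound = s.count g' + 1
      · exact .inl (hfull hc hb')
      · rcases h.full hc g' hg' (by omega) with h1 | ⟨h1, gs', h2, h3⟩
        · exact .inl h1
        · rw [htd] at h2
          simp only [List.mem_cons, reduceCtorEq, false_or] at h2
          exact .inr ⟨h1, gs', by simp [h2], h3⟩
    · simp only [Function.update_of_ne he] at hb
      rcases h.full hc g' hg' hb with h1 | ⟨h1, gs', h2, h3⟩
      · exact .inl h1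
      · rw [htd] at h2
        simp only [List.mem_cons, reduceCtorEq, false_or] at h2
        exact .inr ⟨h1, gs', by simp [h2], h3⟩
  near hc g' hg' hgt hst hgf hb y hy := by
    by_cases he : g' = g
    · subst he
      simp only [Function.update_self] at hb
      rcases hpre with rfl | ⟨rfl, _⟩
      · exact absurd rfl (hnear hb hgt)
      · exact .inr ⟨_, by simp, hy⟩
    · simp only [Function.update_of_ne he] at hb
      rcases h.near hc g' hg' hgt hst
        (fun gs' h' => hgf gs' (by rw [htd] at h'; simp_all)) hb y hy with h1 | ⟨xs, h1, h2⟩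
      · exact .inl h1
      · rw [htd] at h1
        simp only [List.mem_cons, reduceCtorEq, false_or] at h1
        exact .inr ⟨xs, by simp [h1], h2⟩

theorem setupGroup (h : Invariant G S s) {g : NogoodGroup V} {gs : List (NogoodGroup V)}
    {ts : List (Task V)} (htd : s.todo = .setup (g :: gs) :: ts) :
    Invariant G S (State.setupGroup { s with todo := .setup gs :: ts } g) := by
  have hg : ∀ g' ∈ g :: gs, g' ∈ G := h.tasks (.setup (g :: gs)) (by simp [htd])
  have key : ∀ s' : State V, Invariant G S s' → s'.todo = s.todo →
      (s'.conflict = false → g.bound = 0 → s'.Holds g.trigger.neg) →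
      Invariant G S { s' with todo := .setup gs :: ts } := by
    intro s' h' htd' hh
    rw [htd] at htd'
    refine h'.set_todo _ ?_ ?_ ?_ ?_ ?_
    · intro t ht
      rcases List.mem_cons.1 ht with rfl | ht
      · exact fun g' hg' => hg g' (List.mem_cons_of_mem _ hg')
      · exact h'.tasks t (by simp [htd', ht])
    · simp [htd', Task.bumps]
    · rintro hc g' _ hb ⟨gs', h1, h2⟩
      rw [htd', List.mem_cons] at h1
      rcases h1 with h1 | h1
      · cases h1
        rcases List.mem_cons.1 h2 with rfl | h2
        · exact .inl (hh hc hb)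
        · exact .inr ⟨gs, by simp, h2⟩
      · exact .inr ⟨gs', by simp [h1], h2⟩
    · rintro _ g' _ _ ⟨gs', h1, h2⟩
      exact .inl ⟨gs', by simpa [htd'] using h1, h2⟩
    · exact fun _ y xs h1 h2 => .inr ⟨xs, by simpa [htd'] using h1, h2⟩
  unfold State.setupGroup
  split_ifs with hb
  · rw [State.assign_todo]
    refine key _ (h.assign ?_) (by simp) ?_
    · exact UP.trigger_neg (hg g (by simp)) (Finset.empty_subset _) (by simp [hb]) (by simp)
    · intro hc _
      exact (s.holds_assign _).resolve_right (by simp [hc])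
  · exact key s h rfl fun _ h => absurd h hb

theorem bumpGroup (h : Invariant G S s) {g : NogoodGroup V} {gs : List (NogoodGroup V)}
    {ts : List (Task V)} (htd : s.todo = .bump (g :: gs) :: ts) :
    Invariant G S (State.bumpGroup { s with todo := .bump gs :: ts } g) := by
  have hg : g ∈ G := h.tasks (.bump (g :: gs)) (by simp [htd]) g (by simp)
  have hc := h.counts g hg
  rw [htd] at hc
  simp only [List.map_cons, List.sum_cons, Task.bumps, List.count_cons_self] at hc
  unfold State.bumpGroup
  dsimp only
  split_ifs with h1 h2
  · have hup : UP (groupNogoods G) S g.trigger.neg :=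
      UP.trigger_neg hg (Finset.filter_subset _ _) (I := s.processed g) (by omega)
        fun y hy => h.sound y (Finset.mem_filter.1 hy).2.1
    have := (h.assign hup).tick (by simpa using htd) [] (.inl rfl)
      (fun hc _ => (s.holds_assign _).resolve_right (by simp [hc]))
      (by rw [State.count_assign]; omega)
    rw [State.count_assign] at this
    have e := State.assign_count { s with todo := .bump gs :: ts } g.trigger.neg
      (Function.update s.count g (s.count g + 1))
    rw [State.assign_todo] at e
    rw [e]
    exact this
  · exact h.tick htd [.falsify g.lits] (.inr ⟨rfl, by omega, h2.2⟩) (by omega) (by simp)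
  · exact h.tick htd [] (.inl rfl) (by omega) fun h3 h4 => absurd ⟨by omega, h4⟩ h2

theorem fireGroup (h : Invariant G S s) {g : NogoodGroup V} {gs : List (NogoodGroup V)}
    {ts : List (Task V)} (htd : s.todo = .fire (g :: gs) :: ts) :
    Invariant G S (State.fireGroup { s with todo := .fire gs :: ts } g) := by
  have hgs : ∀ g' ∈ g :: gs, g' ∈ G ∧ s.Holds g'.trigger :=
    h.tasks (.fire (g :: gs)) (by simp [htd])
  obtain ⟨hg, hgt⟩ := hgs g (by simp)
  have hc := h.counts g hg
  have hle : s.count g ≤ (s.processed g).card := by omega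
  have key : ∀ pre : List (Task V),
      (pre = [] ∨ pre = [.falsify g.lits] ∧ g.bound = s.count g + 1) →
      (g.bound = s.count g + 1 → pre ≠ []) →
      Invariant G S { s with todo := pre ++ .fire gs :: ts } := by
    intro pre hpre hne
    refine h.set_todo _ ?_ ?_ ?_ ?_ ?_
    · intro t ht
      simp only [List.mem_append, List.mem_cons] at ht
      rcases ht with ht | rfl | ht
      · rcases hpre with rfl | ⟨rfl, hb⟩
        · simp at ht
        · obtain rfl := List.mem_singleton.1 ht
          obtain ⟨J, hJ, hJc⟩ := Finset.exists_subset_card_eq hle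
          refine ⟨g, hg, fun x hx => hx, hgt, J, hJ.trans (Finset.filter_subset _ _), ?_, by omega⟩
          exact fun y hy => (Finset.mem_filter.1 (hJ hy)).2.1
      · exact fun g' hg' => hgs g' (by simp [hg'])
      · exact h.tasks t (by simp [htd, ht])
    · intro g'
      rcases hpre with rfl | ⟨rfl, _⟩ <;> simp [htd, Task.bumps]
    · rintro _ g' _ _ ⟨gs', h1, h2⟩
      refine .inr ⟨gs', ?_, h2⟩
      rw [htd] at h1
      simp_all
    · rintro _ g' _ hb ⟨gs', h1, h2⟩
      rw [htd, List.mem_cons] at h1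
      rcases h1 with h1 | h1
      · cases h1
        rcases List.mem_cons.1 h2 with rfl | h2
        · rcases hpre with rfl | ⟨rfl, _⟩
          · exact absurd rfl (hne hb)
          · exact .inr ⟨_, by simp, fun y hy => hy⟩
        · exact .inl ⟨gs, by simp, h2⟩
      · exact .inl ⟨gs', by simp [h1], h2⟩
    · intro _ y xs h1 h2
      refine .inr ⟨xs, ?_, h2⟩
      rw [htd] at h1
      simp_all
  unfold State.fireGroup
  dsimp only
  split_ifs with h1 h2
  · have hup : UP (groupNogoods G) S g.trigger.neg :=
      UP.trigger_neg hg (Finset.filter_subset _ _) (I := s.processed g) (by omega)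
        fun y hy => h.sound y (Finset.mem_filter.1 hy).2.1
    exact (key [] (.inl rfl) (by omega)).set_conflict ⟨_, h.sound _ hgt, hup⟩
  · exact key [.falsify g.lits] (.inr ⟨rfl, h2.symm⟩) (by simp)
  · exact key [] (.inl rfl) fun h3 => absurd h3.symm h2

theorem falsifyLit (h : Invariant G S s) {x : Lit V} {xs : List (Lit V)}
    {ts : List (Task V)} (htd : s.todo = .falsify (x :: xs) :: ts) :
    Invariant G S (State.falsifyLit { s with todo := .falsify xs :: ts } x) := by
  obtain ⟨g, hg, hxs, hgt, J, hJ, hJh, hb⟩ :=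
    h.tasks (.falsify (x :: xs)) (by simp [htd])
  have key : ∀ s' : State V, Invariant G S s' → s'.todo = s.todo →
      (∀ y, s.Holds y → s'.Holds y) → (s'.conflict = false → s'.val x.var ≠ none) →
      Invariant G S { s' with todo := .falsify xs :: ts } := by
    intro s' h' htd' hmono hval
    rw [htd] at htd'
    refine h'.set_todo _ ?_ ?_ ?_ ?_ ?_
    · intro t ht
      rcases List.mem_cons.1 ht with rfl | ht
      · exact ⟨g, hg, fun y hy => hxs y (List.mem_cons_of_mem _ hy), hmono _ hgt, J, hJ,
          fun y hy => hmono y (hJh y hy), hb⟩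
      · exact h'.tasks t (by simp [htd', ht])
    · simp [htd', Task.bumps]
    · rintro _ g' _ _ ⟨gs', h1, h2⟩
      exact .inr ⟨gs', by simpa [htd'] using h1, h2⟩
    · rintro _ g' _ _ ⟨gs', h1, h2⟩
      exact .inl ⟨gs', by simpa [htd'] using h1, h2⟩
    · intro hc y ys h1 h2
      rw [htd', List.mem_cons] at h1
      rcases h1 with h1 | h1
      · cases h1
        rcases List.mem_cons.1 h2 with rfl | h2
        · exact .inl (hval hc)
        · exact .inr ⟨xs, by simp, h2⟩
      · exact .inr ⟨ys, by simp [h1], h2⟩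
  unfold State.falsifyLit
  dsimp only
  split
  · rename_i hv
    rw [State.assign_todo]
    refine key _ (h.assign ?_) (by simp) (fun y hy => hy.assign _) fun hc => ?_
    · exact UP.lit_neg hg (h.sound _ hgt) hJ hb (fun y hy => h.sound y (hJh y hy))
        (hxs x (by simp)) fun hx => (hJh x hx).val_ne hv
    · exact ((s.holds_assign x.neg).resolve_right (by simp [hc])).val_ne
  · rename_i b hv
    exact key s h rfl (fun y hy => hy) fun _ => by simp [hv]

/-- A finished traversal may be dropped. -/
theorem drop (h : Invariant G S s) {t : Task V} {ts : List (Task V)} (htd : s.todo = t :: ts)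
    (ht : t = .setup [] ∨ t = .bump [] ∨ t = .fire [] ∨ t = .falsify []) :
    Invariant G S { s with todo := ts } := by
  refine h.set_todo _ (fun t' ht' => h.tasks t' (by simp [htd, ht'])) ?_ ?_ ?_ ?_
  · intro g
    rcases ht with rfl | rfl | rfl | rfl <;> simp [htd, Task.bumps]
  · rintro _ g _ _ ⟨gs, h1, h2⟩
    right
    refine ⟨gs, ?_, h2⟩
    rw [htd] at h1
    rcases ht with rfl | rfl | rfl | rfl <;> rcases List.mem_cons.1 h1 with h1 | h1 <;>
      first | exact h1 | (cases h1 <;> simp at h2)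
  · rintro _ g _ _ ⟨gs, h1, h2⟩
    left
    refine ⟨gs, ?_, h2⟩
    rw [htd] at h1
    rcases ht with rfl | rfl | rfl | rfl <;> rcases List.mem_cons.1 h1 with h1 | h1 <;>
      first | exact h1 | (cases h1 <;> simp at h2)
  · rintro _ y xs h1 h2
    right
    refine ⟨xs, ?_, h2⟩
    rw [htd] at h1
    rcases ht with rfl | rfl | rfl | rfl <;> rcases List.mem_cons.1 h1 with h1 | h1 <;>
      first | exact h1 | (cases h1 <;> simp at h2)

theorem of_step (h : Invariant G S s) (hG : G.Nodup) {s' : State V} (hs : step G s = some s') :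
    Invariant G S s' := by
  unfold step at hs
  split_ifs at hs with hc
  split at hs
  · rename_i htd
    split at hs
    · simp at hs
    · rename_i x xs hst
      cases hs
      exact h.pop hG htd hst
  all_goals
    rename_i htd
    cases hs
  · exact h.drop htd (by simp)
  · exact h.setupGroup htd
  · exact h.drop htd (by simp)
  · exact h.bumpGroup htd
  · exact h.drop htd (by simp)
  · exact h.fireGroup htd
  · exact h.drop htd (by simp)
  · exact h.falsifyLit htd

/-- When the propagator has stopped without a conflict, its assignment is closed under
unit-propagation.  A group whose trigger occurs among its own literals would be propagated
incompletely, which `hlits` excludes. -/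
theorem holds_of_up (h : Invariant G S s) (hlits : ∀ g ∈ G, g.trigger ∉ g.lits)
    (hs : step G s = none) (hc : s.conflict = false) {x : Lit V}
    (hx : UP (groupNogoods G) S x) : s.Holds x := by
  obtain ⟨htd, hst⟩ : s.todo = [] ∧ s.stack = [] := by
    unfold step at hs
    rw [if_neg (by simp [hc])] at hs
    split at hs
    · rename_i htd
      split at hs
      · rename_i hst; exact ⟨htd, hst⟩
      · simp at hs
    all_goals simp at hs
  have hcount : ∀ g ∈ G, s.count g = (s.processed g).card := fun g hg => by
    simpa [htd] using h.counts g hg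
  have hfull : ∀ g ∈ G, g.bound ≤ s.count g → s.Holds g.trigger.neg := fun g hg hb => by
    rcases h.full hc g hg hb with h1 | ⟨_, gs, h2, _⟩
    · exact h1
    · simp [htd] at h2
  have hproc : ∀ g : NogoodGroup V, ∀ y ∈ g.lits, s.Holds y → y ∈ s.processed g :=
    fun g y h1 h2 => by simp [State.processed, hst, h1, h2]
  induction hx with
  | given x hx => exact h.given hc x hx
  | unit δ x hδ hxδ _ ih =>
    obtain ⟨g, hg, I, hI, hIc, rfl⟩ := hδ
    have hI' : ∀ y ∈ I, y ∈ g.lits := fun y hy => List.mem_toFinset.1 (hI hy)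
    by_cases hxt : x.neg = g.trigger
    · have hsub : I ⊆ s.processed g := fun y hy =>
        hproc g y (hI' y hy) (ih y (Finset.mem_insert_of_mem hy) fun he =>
          hlits g hg (hxt ▸ he ▸ hI' y hy))
      have := hfull g hg (by rw [hcount g hg, ← hIc]; exact Finset.card_le_card hsub)
      rwa [← hxt, Lit.neg_neg] at this
    · have hgt : s.Holds g.trigger := ih _ (Finset.mem_insert_self _ _) (Ne.symm hxt)
      have hlt : s.count g < g.bound := by
        by_contra hle
        exact hgt.not_neg (hfull g hg (not_lt.1 hle))
      have hxI : x.neg ∈ I := (Finset.mem_insert.1 hxδ).resolve_left hxt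
      have hsub : I.erase x.neg ⊆ s.processed g := fun y hy =>
        hproc g y (hI' y (Finset.mem_of_mem_erase hy))
          (ih y (Finset.mem_insert_of_mem (Finset.mem_of_mem_erase hy)) (Finset.ne_of_mem_erase hy))
      have hle := Finset.card_le_card hsub
      rw [Finset.card_erase_of_mem hxI, hIc, ← hcount g hg] at hle
      rcases h.near hc g hg hgt (by simp [hst]) (by simp [htd]) (by omega) _ (hI' _ hxI)
        with hv | ⟨xs, hxs, _⟩
      · rcases State.holds_or_neg hv with hh | hh
        · have hsub' : I ⊆ s.processed g := fun y hy => by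
            by_cases hyx : y = x.neg
            · exact hyx ▸ hproc g _ (hI' _ hxI) hh
            · exact hsub (Finset.mem_erase.2 ⟨hyx, hy⟩)
          have := Finset.card_le_card hsub'
          rw [hIc, ← hcount g hg] at this
          omega
        · rwa [Lit.neg_neg] at hh
      · simp [htd] at hxs

end Invariant

end Correctness

/-! ### The cost of propagation -/

section Cost

variable {V : Type} [DecidableEq V]

/-- The number of steps a pending traversal may still take.  Firing a group is charged in advance
for the traversal of its literals. -/
def Task.cost : Task V → ℕ
  | .setup gs => gs.length + 1
  | .bump gs => gs.length + 1
  | .fire gs => (gs.map fun g => g.lits.length + 2).sum + 1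
  | .falsify xs => xs.length + 1

/-- The number of steps that taking `x` from the stack may cause. -/
def popCost (G : List (NogoodGroup V)) (x : Lit V) : ℕ :=
  3 + (occurrences G x).length + ((triggered G x).map fun g => g.lits.length + 2).sum

/-- The steps that may still be caused by the variables in `U` that are unassigned. -/
def unassignedCost (G : List (NogoodGroup V)) (U : Finset V) (val : V → Option Bool) : ℕ :=
  ∑ y ∈ U, if val y = none then popCost G ⟨true, y⟩ + popCost G ⟨false, y⟩ else 0

/-- The steps that may still be caused by counters that come within one of their bound. -/
def counterCost (G : List (NogoodGroup V)) (count : NogoodGroup V → ℕ) : ℕ :=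
  ∑ g ∈ G.toFinset, if count g + 1 < g.bound then g.lits.length + 1 else 0

/-- A bound on the number of steps the propagator can still take in all of the branch. -/
def State.potential (G : List (NogoodGroup V)) (U : Finset V) (s : State V) : ℕ :=
  (s.todo.map Task.cost).sum + (s.stack.map (popCost G)).sum + unassignedCost G U s.val +
    counterCost G s.count

theorem unassignedCost_update (G : List (NogoodGroup V)) {U : Finset V} {val : V → Option Bool}
    {y : V} (hy : y ∈ U) (hv : val y = none) (b : Bool) :
    unassignedCost G U (Function.update val y (some b)) +
      (popCost G ⟨true, y⟩ + popCost G ⟨false, y⟩) = unassignedCost G U val := by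
  unfold unassignedCost
  rw [← Finset.add_sum_erase _ _ hy, ← Finset.add_sum_erase _ _ hy]
  simp only [Function.update_self, reduceCtorEq, if_false, zero_add, hv, if_true]
  rw [add_comm]
  congr 1
  refine Finset.sum_congr rfl fun z hz => ?_
  rw [Function.update_of_ne (Finset.ne_of_mem_erase hz)]

theorem popCost_add_three_le (G : List (NogoodGroup V)) (x : Lit V) :
    popCost G x + 3 ≤ popCost G ⟨true, x.var⟩ + popCost G ⟨false, x.var⟩ := by
  obtain ⟨b, y⟩ := x
  have h1 : 3 ≤ popCost G ⟨true, y⟩ := by unfold popCost; omega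
  have h2 : 3 ≤ popCost G ⟨false, y⟩ := by unfold popCost; omega
  cases b <;> simp only <;> omega

theorem State.potential_assign_of_val_eq_none (G : List (NogoodGroup V)) {U : Finset V}
    {s : State V} {x : Lit V} (hx : x.var ∈ U) (hv : s.val x.var = none) :
    (s.assign x).potential G U + 3 ≤ s.potential G U := by
  rcases s.assign_cases x with ⟨h, _⟩ | ⟨h, _⟩ | ⟨_, he⟩
  · exact absurd hv h.val_ne
  · exact absurd hv h.val_ne
  · rw [he]
    have h1 := unassignedCost_update G hx hv x.sign
    have h2 := popCost_add_three_le G x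
    simp only [State.potential, List.map_cons, List.sum_cons]
    omega

theorem State.potential_assign_le (G : List (NogoodGroup V)) {U : Finset V} (s : State V)
    {x : Lit V} (hx : x.var ∈ U) : (s.assign x).potential G U ≤ s.potential G U := by
  by_cases hv : s.val x.var = none
  · have := State.potential_assign_of_val_eq_none G hx hv
    omega
  · rcases s.assign_cases x with ⟨_, he⟩ | ⟨_, he⟩ | ⟨h, _⟩
    · rw [he]
    · rw [he]; exact le_rfl
    · exact absurd h hv

theorem counterCost_update {G : List (NogoodGroup V)} {g : NogoodGroup V} (hg : g ∈ G)
    (count : NogoodGroup V → ℕ) :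
    counterCost G (Function.update count g (count g + 1)) +
      (if count g + 2 = g.bound then g.lits.length + 1 else 0) ≤ counterCost G count := by
  unfold counterCost
  have hg' := List.mem_toFinset.2 hg
  rw [← Finset.add_sum_erase _ _ hg', ← Finset.add_sum_erase _ _ hg']
  have : ∑ h ∈ G.toFinset.erase g, (if Function.update count g (count g + 1) h + 1 < h.bound
        then h.lits.length + 1 else 0) =
      ∑ h ∈ G.toFinset.erase g, (if count h + 1 < h.bound then h.lits.length + 1 else 0) :=
    Finset.sum_congr rfl fun h hh => by rw [Function.update_of_ne (Finset.ne_of_mem_erase hh)]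
  rw [this, Function.update_self]
  split_ifs <;> omega

/-- Every step of the propagator lowers the potential. -/
theorem Invariant.potential_step {G : List (NogoodGroup V)} {S : Set (Lit V)} {s s' : State V}
    (h : Invariant G S s) {U : Finset V}
    (hU : ∀ g ∈ G, g.trigger.var ∈ U ∧ ∀ y ∈ g.lits, y.var ∈ U) (hs : step G s = some s') :
    s'.potential G U + 1 ≤ s.potential G U := by
  unfold step at hs
  split_ifs at hs with hc
  split at hs
  · rename_i htd
    split at hs
    · simp at hs
    · rename_i x xs hst
      cases hs
      simp only [State.potential, htd, hst, List.map_cons, List.map_nil, List.sum_cons,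
        List.sum_nil, Task.cost, popCost]
      omega
  all_goals
    rename_i htd
    cases hs
  case h_2 => simp [State.potential, htd, Task.cost]
  case h_4 => simp [State.potential, htd, Task.cost]
  case h_6 => simp [State.potential, htd, Task.cost]
  case h_8 => simp [State.potential, htd, Task.cost]
  case h_3 g gs ts =>
    have hg : g ∈ G := h.tasks (.setup (g :: gs)) (by simp [htd]) g (by simp)
    have key : State.potential G U { s with todo := .setup gs :: ts } + 1 ≤ s.potential G U := by
      simp only [State.potential, htd, List.map_cons, List.sum_cons, Task.cost, List.length_cons]
      omega
    unfold State.setupGroup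
    split_ifs
    · exact (Nat.add_le_add_right (State.potential_assign_le G _ (x := g.trigger.neg)
        (hU g hg).1) 1).trans key
    · exact key
  case h_5 g gs ts =>
    have hg : g ∈ G := h.tasks (.bump (g :: gs)) (by simp [htd]) g (by simp)
    have hcost := counterCost_update hg s.count
    have key : State.potential G U { s with
        count := Function.update s.count g (s.count g + 1), todo := .bump gs :: ts } + 1 +
        (if s.count g + 2 = g.bound then g.lits.length + 1 else 0) ≤ s.potential G U := by
      simp only [State.potential, htd, List.map_cons, List.sum_cons, Task.cost, List.length_cons]
      omega
    unfold State.bumpGroup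
    dsimp only
    split_ifs with h1 h2
    · exact (Nat.add_le_add_right (State.potential_assign_le G _ (x := g.trigger.neg)
        (hU g hg).1) 1).trans (by omega)
    · rw [if_pos h2.1] at key
      simp only [State.push, State.potential, List.map_cons, List.sum_cons, Task.cost] at key ⊢
      omega
    · omega
  case h_7 g gs ts =>
    have key : State.potential G U { s with todo := .fire gs :: ts } + (g.lits.length + 2) ≤
        s.potential G U := by
      simp only [State.potential, htd, List.map_cons, List.sum_cons, Task.cost]
      omega
    unfold State.fireGroup
    dsimp only
    split_ifs with h1 h2
    · simp only [State.potential] at key ⊢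
      omega
    · simp only [State.push, State.potential, List.map_cons, List.sum_cons, Task.cost] at key ⊢
      omega
    · omega
  case h_9 x xs ts =>
    obtain ⟨g, hg, hxs, -⟩ := h.tasks (.falsify (x :: xs)) (by simp [htd])
    have key : State.potential G U { s with todo := .falsify xs :: ts } + 1 ≤ s.potential G U := by
      simp only [State.potential, htd, List.map_cons, List.sum_cons, Task.cost, List.length_cons]
      omega
    unfold State.falsifyLit
    split
    · exact (Nat.add_le_add_right (State.potential_assign_le G _ (x := x.neg)
        ((hU g hg).2 x (hxs x (by simp)))) 1).trans key
    · exact key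

/-- The propagator stops, within the number of steps by which the potential drops. -/
theorem Invariant.exists_exec {G : List (NogoodGroup V)} (hG : G.Nodup) {S : Set (Lit V)}
    {U : Finset V} (hU : ∀ g ∈ G, g.trigger.var ∈ U ∧ ∀ y ∈ g.lits, y.var ∈ U) (k : ℕ)
    {s : State V} (h : Invariant G S s) (hk : s.potential G U ≤ k) :
    ∃ t s', Exec G s t s' ∧ t + s'.potential G U ≤ s.potential G U ∧ Invariant G S s' ∧
      step G s' = none := by
  induction k generalizing s with
  | zero =>
    rcases hs : step G s with _ | s₁
    · exact ⟨0, s, .done s hs, by omega, h, hs⟩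
    · have := h.potential_step hU hs
      omega
  | succ k ih =>
    rcases hs : step G s with _ | s₁
    · exact ⟨0, s, .done s hs, by omega, h, hs⟩
    · have hlt := h.potential_step hU hs
      obtain ⟨t, s', he, ht, h', hs'⟩ := ih (h.of_step hG hs) (by omega)
      exact ⟨t + 1, s', .next s s₁ s' t hs he, by omega, h', hs'⟩

theorem Invariant.conflict_iff {G : List (NogoodGroup V)} {S : Set (Lit V)} {s : State V}
    (h : Invariant G S s) (hlits : ∀ g ∈ G, g.trigger ∉ g.lits) (hs : step G s = none) :
    s.conflict = true ↔ Conflict (groupNogoods G) S := by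
  refine ⟨h.fails, ?_⟩
  rintro ⟨x, h1, h2⟩
  by_contra hc
  rw [Bool.not_eq_true] at hc
  exact (h.holds_of_up hlits hs hc h1).not_neg (h.holds_of_up hlits hs hc h2)

theorem sum_length_filter_mem_le {α β : Type} [DecidableEq β] (L : List α) (f : α → List β)
    (X : Finset β) :
    ∑ x ∈ X, (L.filter fun a => decide (x ∈ f a)).length ≤ (L.map fun a => (f a).length).sum := by
  induction L with
  | nil => simp
  | cons a L ih =>
    have : ∀ x, ((a :: L).filter fun a => decide (x ∈ f a)).length =
        (if x ∈ f a then 1 else 0) + (L.filter fun a => decide (x ∈ f a)).length := by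
      intro x
      by_cases hx : x ∈ f a <;> simp [hx, add_comm]
    simp only [this, Finset.sum_add_distrib, List.map_cons, List.sum_cons]
    refine Nat.add_le_add ?_ ih
    rw [← Finset.sum_filter, Finset.sum_const, smul_eq_mul, mul_one]
    refine (Finset.card_le_card (t := (f a).toFinset) fun x hx => ?_).trans
      (List.toFinset_card_le _)
    exact List.mem_toFinset.2 (Finset.mem_filter.1 hx).2

theorem sum_triggered_le (G : List (NogoodGroup V)) (X : Finset (Lit V)) (f : NogoodGroup V → ℕ) :
    ∑ x ∈ X, ((triggered G x).map f).sum ≤ (G.map f).sum := by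
  induction G with
  | nil => simp [triggered]
  | cons g G ih =>
    have : ∀ x, ((triggered (g :: G) x).map f).sum =
        (if x = g.trigger then f g else 0) + ((triggered G x).map f).sum := by
      intro x
      unfold triggered
      by_cases hx : g.trigger = x
      · simp [hx]
      · simp [hx, Ne.symm hx]
    simp only [this, Finset.sum_add_distrib, List.map_cons, List.sum_cons]
    refine Nat.add_le_add ?_ ih
    rw [Finset.sum_ite_eq']
    split_ifs <;> simp

theorem sum_popCost_le (G : List (NogoodGroup V)) (X : Finset (Lit V)) :
    ∑ x ∈ X, popCost G x ≤ 3 * X.card + 3 * size G := by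
  unfold popCost
  rw [Finset.sum_add_distrib, Finset.sum_add_distrib, Finset.sum_const, smul_eq_mul]
  have h1 : ∑ x ∈ X, (occurrences G x).length ≤ _ :=
    sum_length_filter_mem_le G NogoodGroup.lits X
  have h2 := sum_triggered_le G X fun g => g.lits.length + 2
  have h3 : (G.map fun g => g.lits.length).sum + (G.map fun g => g.lits.length + 2).sum ≤
      3 * size G := by
    unfold size
    clear h1 h2
    induction G with
    | nil => simp
    | cons g G ih => simp only [List.map_cons, List.sum_cons]; omega
  omega

theorem unassignedCost_le (G : List (NogoodGroup V)) (U : Finset V) :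
    unassignedCost G U (fun _ => none) ≤ 6 * U.card + 6 * size G := by
  have hs : ∀ b : Bool, ∑ y ∈ U, popCost G ⟨b, y⟩ ≤ 3 * U.card + 3 * size G := by
    intro b
    have hinj : Function.Injective fun y : V => (⟨b, y⟩ : Lit V) := fun y z h => by
      simpa using h
    have := sum_popCost_le G (U.map ⟨_, hinj⟩)
    simpa using this
  simp only [unassignedCost, if_true, Finset.sum_add_distrib]
  have := hs true
  have := hs false
  omega

theorem potential_start_le {G : List (NogoodGroup V)} (hG : G.Nodup) (U : Finset V) :
    (State.start G).potential G U ≤ 6 * U.card + 8 * size G + 1 := by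
  have h1 := unassignedCost_le G U
  have h2 : counterCost G (fun _ => 0) ≤ size G := by
    unfold counterCost size
    rw [← List.sum_toFinset _ hG]
    refine Finset.sum_le_sum fun g _ => ?_
    split_ifs <;> omega
  have h3 : G.length ≤ size G := by
    unfold size
    clear h1 h2 hG
    induction G with
    | nil => simp
    | cons g G ih => simp only [List.map_cons, List.sum_cons, List.length_cons]; omega
  simp only [State.potential, State.start, List.map_cons, List.map_nil, List.sum_cons,
    List.sum_nil, Task.cost]
  omega

end Cost

section Branch

variable {A : Type} [DecidableEq A] {P : Program A}

/-- Down a branch the propagator computes the derived literals, at a total cost bounded by the size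
of the groups and the number of variables.  Every decision that does not fail at once assigns a
variable and so is paid for by the potential, and only the last decision can fail. -/
theorem IsBranch.exists_run (hU : ∀ g ∈ P.groups,
      g.trigger.var ∈ P.vars ∧ ∀ y ∈ g.lits, y.var ∈ P.vars)
    (hlits : ∀ g ∈ P.groups, g.trigger ∉ g.lits) {ds : List (Lit (Var A))} (h : IsBranch P ds) :
    ∃ t s, Run P.groups ds t s ∧ t ≤ 9 * size P.groups + 6 * P.vars.length + 2 ∧
      (s.conflict = true ↔ Fails P ds) ∧ (¬ Fails P ds → ∀ x, s.Holds x ↔ Derives P ds x) := by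
  set G := P.groups with hGdef
  have hG : G.Nodup := List.nodup_dedup _
  set U := P.vars.toFinset with hUdef
  have hU' : ∀ g ∈ G, g.trigger.var ∈ U ∧ ∀ y ∈ g.lits, y.var ∈ U := by
    simpa [hUdef] using hU
  have hcard : U.card ≤ P.vars.length := List.toFinset_card_le _
  set K := 9 * size G + 6 * P.vars.length + 1 with hK
  suffices ∃ t s, Run G ds t s ∧ Invariant G {y | y ∈ ds} s ∧ step G s = none ∧
      t + s.potential G U ≤ K + 1 ∧ (s.conflict = false → t + s.potential G U ≤ K) by
    obtain ⟨t, s, hr, hi, hs, ht, -⟩ := this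
    refine ⟨t, s, hr, by omega, hi.conflict_iff hlits hs, fun hf x => ⟨hi.sound x, fun hx => ?_⟩⟩
    refine hi.holds_of_up hlits hs ?_ hx
    rw [← Bool.not_eq_true]
    exact fun hc => hf (hi.fails hc)
  induction h with
  | root =>
    have h0 : Invariant G {y | y ∈ ([] : List (Lit (Var A)))} (State.start G) := by
      simpa using Invariant.start G
    obtain ⟨t, s, he, ht, hi, hs⟩ := h0.exists_exec hG hU' _ le_rfl
    have := potential_start_le hG U
    exact ⟨size G + t, s, .root t s he, hi, hs, by omega, fun _ => by omega⟩
  | decide ds x _ hf hx hd ih =>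
    obtain ⟨t, s, hr, hi, hs, -, ht⟩ := ih
    have hc : s.conflict = false := by
      rw [← Bool.not_eq_true]
      exact fun hc => hf (hi.fails hc)
    have hnx : ¬ s.Holds x := fun h => hd (hi.sound x h)
    have hxU : x.var ∈ U := List.mem_toFinset.2 hx
    have hset : insert x {y | y ∈ ds} = {y | y ∈ ds ++ [x]} := by
      ext y; simp [or_comm]
    have h1 := hset ▸ hi.insert_of_assign x
    obtain ⟨t', s', he, ht', hi', hs'⟩ := h1.exists_exec hG hU' _ le_rfl
    have ht := ht hc
    refine ⟨t + 1 + t', s', .decide ds x t t' s s' hr he, hi', hs', ?_, fun hc' => ?_⟩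
    · have := s.potential_assign_le G hxU
      omega
    · have hv : s.val x.var = none := by
        by_contra hv
        -- A false decision stops the propagator at once, with a conflict.
        have hn := (State.holds_or_neg hv).resolve_left hnx
        have hac : (s.assign x).conflict = true := by
          rcases s.assign_cases x with ⟨h, _⟩ | ⟨_, he⟩ | ⟨h, _⟩
          · exact absurd h hnx
          · rw [he]
          · exact absurd h hv
        cases he with
        | done _ _ => simp [hac] at hc'
        | next _ s₁ _ t hst _ => simp [step, hac] at hst
      have := State.potential_assign_of_val_eq_none G hxU hv
      omega

end Branch

/-! ### The size of the completion of a program -/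

section Completion

variable {A : Type} [DecidableEq A]

/-- The number of atom occurrences and rules of `P`. -/
def Program.length (P : Program A) : ℕ :=
  (P.map fun r => r.head.atoms.length + r.body.lits.length + 1).sum

theorem Program.atom_mem_vars {P : Program A} {a : A} : .atom a ∈ P.vars ↔ a ∈ P.atoms := by
  simp [Program.vars]

theorem Program.body_mem_vars {P : Program A} {β : Body A} : .body β ∈ P.vars ↔ β ∈ P.bodies := by
  simp [Program.vars]

theorem Program.body_mem_bodies {P : Program A} {r : Rule A} (hr : r ∈ P) : r.body ∈ P.bodies :=
  List.mem_dedup.2 (List.mem_map_of_mem hr)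

theorem Program.mem_atoms {P : Program A} {a : A} :
    a ∈ P.atoms ↔ ∃ r ∈ P, a ∈ r.head.atoms ∨ ∃ x ∈ r.body.lits, x.var = a := by
  simp [Program.atoms]

theorem Program.mem_supports {P : Program A} {a : A} {β : Body A} :
    β ∈ P.supports a ↔ ∃ r ∈ P, a ∈ r.head.atoms ∧ r.body = β := by
  simp [Program.supports, and_assoc]

theorem Program.mem_forcing {P : Program A} {a : A} {β : Body A} :
    β ∈ P.forcing a ↔ ∃ r ∈ P, r.head = .atom a ∧ r.body = β := by
  simp [Program.forcing, and_assoc]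

theorem Program.mem_groups {P : Program A} {g : NogoodGroup (Var A)} :
    g ∈ P.groups ↔ (∃ β ∈ P.bodies, g ∈ bodyGroups β) ∨ (∃ a ∈ P.atoms, g ∈ atomGroups P a) ∨
      g ∈ integrityGroups P := by
  simp [Program.groups]

theorem Program.var_mem_vars_of_mem_groups {P : Program A} {g : NogoodGroup (Var A)}
    (hg : g ∈ P.groups) : g.trigger.var ∈ P.vars ∧ ∀ y ∈ g.lits, y.var ∈ P.vars := by
  rcases Program.mem_groups.1 hg with ⟨β, hβ, hg⟩ | ⟨a, ha, hg⟩ | hg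
  · have hlit : ∀ x ∈ β.lits, (Var.atom x.var) ∈ P.vars := fun x hx => by
      obtain ⟨r, hr, rfl⟩ := List.mem_map.1 (List.mem_dedup.1 hβ)
      exact Program.atom_mem_vars.2 (Program.mem_atoms.2 ⟨r, hr, .inr ⟨x, hx, rfl⟩⟩)
    simp only [bodyGroups, List.mem_cons, List.not_mem_nil, or_false] at hg
    rcases hg with rfl | rfl <;> refine ⟨Program.body_mem_vars.2 hβ, fun y hy => ?_⟩ <;>
      obtain ⟨x, hx, rfl⟩ := List.mem_map.1 hy <;> exact hlit x hx
  · simp only [atomGroups, List.mem_cons, List.not_mem_nil, or_false] at hg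
    rcases hg with rfl | rfl <;> refine ⟨Program.atom_mem_vars.2 ha, fun y hy => ?_⟩ <;>
      obtain ⟨β, hβ, rfl⟩ := List.mem_map.1 hy <;> refine Program.body_mem_vars.2 ?_
    · obtain ⟨r, hr, -, rfl⟩ := Program.mem_forcing.1 hβ
      exact Program.body_mem_bodies hr
    · obtain ⟨r, hr, -, rfl⟩ := Program.mem_supports.1 hβ
      exact Program.body_mem_bodies hr
  · obtain ⟨r, hr, rfl⟩ := List.mem_map.1 hg
    exact ⟨Program.body_mem_vars.2 (Program.body_mem_bodies (List.mem_filter.1 hr).1), by simp⟩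

theorem Program.trigger_notMem_lits {P : Program A} {g : NogoodGroup (Var A)}
    (hg : g ∈ P.groups) : g.trigger ∉ g.lits := by
  rcases Program.mem_groups.1 hg with ⟨β, hβ, hg⟩ | ⟨a, ha, hg⟩ | hg
  · simp only [bodyGroups, List.mem_cons, List.not_mem_nil, or_false] at hg
    rcases hg with rfl | rfl <;> simp [Lit.lift, Lit.neg]
  · simp only [atomGroups, List.mem_cons, List.not_mem_nil, or_false] at hg
    rcases hg with rfl | rfl <;> simp
  · obtain ⟨r, hr, rfl⟩ := List.mem_map.1 hg
    simp

theorem sum_map_flatMap {α β : Type} (l : List α) (f : α → List β) (g : β → ℕ) :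
    ((l.flatMap f).map g).sum = (l.map fun a => ((f a).map g).sum).sum := by
  induction l with
  | nil => rfl
  | cons a l ih => simp [ih]

theorem sum_map_dedup_le {α : Type} [DecidableEq α] (l : List α) (f : α → ℕ) :
    (l.dedup.map f).sum ≤ (l.map f).sum :=
  ((List.dedup_sublist l).map f).sum_le_sum (by simp)

theorem Program.length_vars_le (P : Program A) : P.vars.length ≤ P.length := by
  have h1 : P.atoms.length ≤ (P.map fun r => r.head.atoms.length + r.body.lits.length).sum := by
    refine (List.dedup_sublist _).length_le.trans ?_
    simp [List.length_flatMap]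
  have h2 : P.bodies.length ≤ List.length (α := Rule A) P :=
    (List.dedup_sublist _).length_le.trans (by simp)
  have h3 : P.length = (P.map fun r => r.head.atoms.length + r.body.lits.length).sum +
      List.length (α := Rule A) P := by
    unfold Program.length
    rw [List.sum_map_add]
    simp
  simp only [Program.vars, List.length_append, List.length_map]
  omega

theorem Program.sum_length_supports_le (P : Program A) :
    (P.atoms.map fun a => (P.supports a).length).sum ≤
      (P.map fun r => r.head.atoms.length).sum := by
  rw [← List.sum_toFinset _ (show P.atoms.Nodup from List.nodup_dedup _)]
  refine le_trans (Finset.sum_le_sum fun a _ => ?_)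
    (sum_length_filter_mem_le P (fun r => r.head.atoms) P.atoms.toFinset)
  exact (List.dedup_sublist _).length_le.trans (by simp)

theorem Program.sum_length_forcing_le (P : Program A) :
    (P.atoms.map fun a => (P.forcing a).length).sum ≤
      (P.map fun r => r.head.atoms.length).sum := by
  rw [← List.sum_toFinset _ (show P.atoms.Nodup from List.nodup_dedup _)]
  refine le_trans (Finset.sum_le_sum fun a _ => ?_)
    (sum_length_filter_mem_le P (fun r => r.head.atoms) P.atoms.toFinset)
  refine (List.dedup_sublist _).length_le.trans ?_
  rw [List.length_map]
  refine (List.monotone_filter_right P fun r hr => ?_).length_le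
  rw [of_decide_eq_true hr]
  simp [Head.atoms]

theorem Program.size_groups_le (P : Program A) : size P.groups ≤ 4 * P.length := by
  have h0 := P.length_vars_le
  have hs := P.sum_length_supports_le
  have hf := P.sum_length_forcing_le
  have h1 : ((P.bodies.flatMap bodyGroups).map fun g => g.lits.length + 1).sum ≤
      (P.map fun r => 2 * (r.body.lits.length + 1)).sum := by
    rw [sum_map_flatMap]
    refine (sum_map_dedup_le _ _).trans (le_of_eq ?_)
    rw [List.map_map]
    congr 1
    refine List.map_congr_left fun r _ => ?_
    simp [bodyGroups]
    omega
  have h2 : ((P.atoms.flatMap (atomGroups P)).map fun g => g.lits.length + 1).sum =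
      (P.atoms.map fun a => (P.forcing a).length).sum +
        (P.atoms.map fun a => (P.supports a).length).sum + 2 * P.atoms.length := by
    rw [sum_map_flatMap]
    have : ∀ a, ((atomGroups P a).map fun g => g.lits.length + 1).sum =
        (P.forcing a).length + (P.supports a).length + 2 := fun a => by
      simp [atomGroups]; omega
    simp only [this, List.sum_map_add]
    simp [mul_comm]
  have h3 : ((integrityGroups P).map fun g => g.lits.length + 1).sum ≤
      List.length (α := Rule A) P := by
    unfold integrityGroups
    rw [List.map_map]
    have := (List.filter_sublist (p := fun r : Rule A => decide (r.head = Head.bot))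
      (l := P)).length_le
    simpa [Function.comp_def] using this
  have h4 : size P.groups ≤ _ :=
    sum_map_dedup_le _ fun g : NogoodGroup (Var A) => g.lits.length + 1
  rw [List.map_append, List.map_append, List.sum_append, List.sum_append] at h4
  have h5 : P.length = (P.map fun r => r.head.atoms.length).sum +
      (P.map fun r => r.body.lits.length).sum + List.length (α := Rule A) P := by
    unfold Program.length
    simp [List.sum_map_add]
  have h6 : (P.map fun r => 2 * (r.body.lits.length + 1)).sum =
      2 * (P.map fun r => r.body.lits.length).sum + 2 * List.length (α := Rule A) P := by
    rw [List.sum_map_mul_left, List.sum_map_add]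
    simp [mul_add]
  have h7 : P.atoms.length ≤ (P.map fun r => r.head.atoms.length).sum +
      (P.map fun r => r.body.lits.length).sum := by
    refine (List.dedup_sublist _).length_le.trans ?_
    simp [List.length_flatMap, List.sum_map_add]
  omega

/-- Propagation down a branch is linear in the size of the program. -/
theorem IsBranch.exists_run_le {P : Program A} {ds : List (Lit (Var A))} (h : IsBranch P ds) :
    ∃ t s, Run P.groups ds t s ∧ t ≤ 42 * P.length + 2 ∧
      (s.conflict = true ↔ Fails P ds) ∧ (¬ Fails P ds → ∀ x, s.Holds x ↔ Derives P ds x) := by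
  obtain ⟨t, s, hr, ht, hs⟩ := h.exists_run (fun g hg => Program.var_mem_vars_of_mem_groups hg)
    fun g hg => Program.trigger_notMem_lits hg
  have h1 := P.size_groups_le
  have h2 := P.length_vars_le
  exact ⟨t, s, hr, by omega, hs⟩

end Completion

section EncodingSize

theorem Program.length_append {A : Type} (P Q : Program A) :
    Program.length (P ++ Q) = P.length + Q.length := by
  simp [Program.length]

theorem length_intervals_le (d : ℕ) : (intervals d).length ≤ d ^ 2 := by
  unfold intervals
  rw [List.length_flatMap, pow_two]
  refine (List.sum_le_card_nsmul _ d ?_).trans (by simp)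
  intro k hk
  obtain ⟨l, hl, rfl⟩ := List.mem_map.1 hk
  have := (List.mem_range'_1.1 hl).1
  simp
  omega

theorem length_conj_le {A : Type} [DecidableEq A] (L : List (Lit A)) :
    (Body.conj L).lits.length ≤ L.length :=
  (List.dedup_sublist L).length_le

theorem length_encoding_le {n d : ℕ} (hn : 1 ≤ n) (hd : 1 ≤ d) :
    (encoding n d).length ≤ 30 * (n * d ^ 2) := by
  have hI := length_intervals_le d
  have h1 : (reifyRules n).length ≤ 6 := by
    simp [Program.length, reifyRules, Head.atoms, Body.conj]
  have h2 : (hallRules n d).length ≤ (n + 2) * d ^ 2 := by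
    unfold Program.length hallRules
    rw [List.map_map]
    refine (List.sum_le_card_nsmul _ (n + 2) ?_).trans ?_
    · intro k hk
      obtain ⟨I, -, rfl⟩ := List.mem_map.1 hk
      have := (List.dedup_sublist ((List.finRange n).map fun v =>
        pos (Atom.r v I.1 I.2))).length_le
      simp only [List.length_map, List.length_finRange] at this
      simp only [Function.comp_apply, Head.atoms, List.length_cons, List.length_nil, Body.card]
      omega
    · rw [List.length_map, smul_eq_mul, mul_comm]
      exact Nat.mul_le_mul le_rfl hI
  have h3 : (boundRules n d).length ≤ n * (4 * d + 4) := by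
    unfold Program.length boundRules
    rw [sum_map_flatMap]
    refine (List.sum_le_card_nsmul _ (4 * d + 4) ?_).trans (by simp)
    intro k hk
    obtain ⟨v, -, rfl⟩ := List.mem_map.1 hk
    rw [List.map_append, List.map_append, List.sum_append, List.sum_append, List.map_map]
    have : (((List.range' 1 (d - 1)).map ((fun r : Rule (Atom n) =>
        r.head.atoms.length + r.body.lits.length + 1) ∘ fun i =>
          ⟨.bot, .conj [pos (.b v i), naf (.b v (i + 1))]⟩)).sum) ≤ (d - 1) * 3 := by
      refine (List.sum_le_card_nsmul _ 3 ?_).trans (by simp)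
      intro k hk
      obtain ⟨i, -, rfl⟩ := List.mem_map.1 hk
      have := length_conj_le [pos (Atom.b v i), naf (Atom.b v (i + 1))]
      simp only [List.length_cons, List.length_nil] at this
      simp only [Function.comp_apply, Head.atoms, List.length_nil]
      omega
    refine (Nat.add_le_add_right (Nat.add_le_add_left this _) _).trans ?_
    simp [Head.atoms, Body.conj]
    omega
  have h4 : (linkRules n d).length ≤ n * (d ^ 2 * 10) := by
    unfold Program.length linkRules
    rw [sum_map_flatMap]
    refine (List.sum_le_card_nsmul _ (d ^ 2 * 10) ?_).trans (by simp)
    intro k hk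
    obtain ⟨v, -, rfl⟩ := List.mem_map.1 hk
    rw [sum_map_flatMap]
    refine (List.sum_le_card_nsmul _ 10 ?_).trans
      (by rw [List.length_map, smul_eq_mul]; exact Nat.mul_le_mul hI le_rfl)
    intro k hk
    obtain ⟨I, -, rfl⟩ := List.mem_map.1 hk
    have e1 := length_conj_le [naf (Atom.b v (I.1 - 1)), pos (Atom.b v I.2)]
    have e2 := length_conj_le [pos (Atom.r v I.1 I.2), pos (Atom.b v (I.1 - 1))]
    have e3 := length_conj_le [pos (Atom.r v I.1 I.2), naf (Atom.b v I.2)]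
    simp only [List.length_cons, List.length_nil] at e1 e2 e3
    simp only [List.map_cons, List.map_nil, List.sum_cons, List.sum_nil, Head.atoms,
      List.length_cons, List.length_nil]
    omega
  have h5 : (encoding n d).length = (reifyRules n).length + (hallRules n d).length +
      (boundRules n d).length + (linkRules n d).length := by
    simp only [encoding, Program.length_append]
  have hd2 : d ≤ d ^ 2 := Nat.le_self_pow (by norm_num) d
  have a1 : n * d ≤ n * d ^ 2 := Nat.mul_le_mul le_rfl hd2
  have a2 : d ^ 2 ≤ n * d ^ 2 := Nat.le_mul_of_pos_left _ hn
  have a3 : n ≤ n * d ^ 2 := Nat.le_mul_of_pos_right _ (by positivity)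
  have a4 : 1 ≤ n * d ^ 2 := hn.trans a3
  nlinarith

end EncodingSize

/-! ### Hall's theorem for intervals -/

section Hall

variable {ι : Type} [Fintype ι]

/-- For intervals `[lo i, hi i]` Hall's condition has to be checked only for the families of all
intervals inside a given one: a family whose union is not an interval splits at a gap. -/
theorem exists_injective_of_card_le {lo hi : ι → ℕ} {a b : ℕ} (h : ∀ i, lo i ≤ hi i)
    (ha : ∀ i, a ≤ lo i) (hb : ∀ i, hi i ≤ b)
    (hH : ∀ l u, a ≤ l → l ≤ u → u ≤ b →
      (Finset.univ.filter fun i => l ≤ lo i ∧ hi i ≤ u).card ≤ u + 1 - l) :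
    ∃ f : ι → ℕ, Function.Injective f ∧ ∀ i, lo i ≤ f i ∧ f i ≤ hi i := by
  suffices hs : ∀ s : Finset ι, s.card ≤ (s.biUnion fun i => Finset.Icc (lo i) (hi i)).card by
    obtain ⟨f, hf, hm⟩ := (Finset.all_card_le_biUnion_card_iff_exists_injective _).1 hs
    exact ⟨f, hf, fun i => Finset.mem_Icc.1 (hm i)⟩
  intro s
  induction s using Finset.strongInduction with
  | H s ih =>
    rcases s.eq_empty_or_nonempty with rfl | hne
    · simp
    obtain ⟨i, his, hi_min⟩ := Finset.exists_min_image s lo hne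
    obtain ⟨j, hjs, hj_max⟩ := Finset.exists_max_image s hi hne
    have hij : lo i ≤ hi j := (hi_min j hjs).trans (h j)
    by_cases hgap : ∃ g, lo i ≤ g ∧ g ≤ hi j ∧ ∀ k ∈ s, ¬ (lo k ≤ g ∧ g ≤ hi k)
    · obtain ⟨g, hg1, hg2, hg⟩ := hgap
      have hgi : hi i < g := by have := hg i his; omega
      have hgj : g < lo j := by have := hg j hjs; omega
      have hlt1 : s.filter (fun k => hi k < g) ⊂ s :=
        Finset.filter_ssubset.2 ⟨j, hjs, by omega⟩
      have hlt2 : s.filter (fun k => ¬ hi k < g) ⊂ s :=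
        Finset.filter_ssubset.2 ⟨i, his, by omega⟩
      have hsplit := Finset.card_filter_add_card_filter_not (s := s) (fun k => hi k < g)
      rw [← hsplit]
      refine (Nat.add_le_add (ih _ hlt1) (ih _ hlt2)).trans ?_
      rw [← Finset.card_union_of_disjoint]
      · refine Finset.card_le_card (Finset.union_subset ?_ ?_) <;>
          exact Finset.biUnion_subset_biUnion_of_subset_left _ (Finset.filter_subset _ _)
      · rw [Finset.disjoint_left]
        intro x hx1 hx2
        simp only [Finset.mem_biUnion, Finset.mem_filter, Finset.mem_Icc] at hx1 hx2
        obtain ⟨k, ⟨-, hk⟩, -, hkx⟩ := hx1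
        obtain ⟨m, ⟨hms, hm⟩, hmx, -⟩ := hx2
        have := hg m hms
        omega
    · push Not at hgap
      calc s.card ≤ (Finset.univ.filter fun k => lo i ≤ lo k ∧ hi k ≤ hi j).card :=
            Finset.card_le_card fun k hk => by simp [hi_min k hk, hj_max k hk]
        _ ≤ hi j + 1 - lo i := hH _ _ (ha i) hij (hb j)
        _ = (Finset.Icc (lo i) (hi j)).card := (Nat.card_Icc _ _).symm
        _ ≤ _ := Finset.card_le_card fun g hg => by
            obtain ⟨hg1, hg2⟩ := Finset.mem_Icc.1 hg
            obtain ⟨k, hk, hk1, hk2⟩ := hgap g hg1 hg2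
            exact Finset.mem_biUnion.2 ⟨k, hk, Finset.mem_Icc.2 ⟨hk1, hk2⟩⟩

/-- An end of `[lo v, hi v]` has a support if no interval contains too many domains and the
intervals that contain as many domains as they have values contain no end of another domain:
then Hall's condition survives the assignment of that end to `v`. -/
theorem exists_support_of_card_le [DecidableEq ι] {lo hi : ι → ℕ} {a b : ℕ} (h : ∀ i, lo i ≤ hi i)
    (ha : ∀ i, a ≤ lo i) (hb : ∀ i, hi i ≤ b)
    (hH : ∀ l u, a ≤ l → l ≤ u → u ≤ b →
      (Finset.univ.filter fun i => l ≤ lo i ∧ hi i ≤ u).card ≤ u + 1 - l)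
    (v : ι) {x : ℕ} (hx : lo v ≤ x ∧ x ≤ hi v)
    (hv : ∀ l u, a ≤ l → l ≤ u → u ≤ b →
      (Finset.univ.filter fun i => l ≤ lo i ∧ hi i ≤ u).card = u + 1 - l →
      l ≤ x → x ≤ u → l ≤ lo v ∧ hi v ≤ u) :
    ∃ f : ι → ℕ, Function.Injective f ∧ f v = x ∧ ∀ i, lo i ≤ f i ∧ f i ≤ hi i := by
  obtain ⟨f, hf, hm⟩ := exists_injective_of_card_le
    (lo := Function.update lo v x) (hi := Function.update hi v x) (a := a) (b := b)
    (fun i => by by_cases hi : i = v <;> simp [hi, h])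
    (fun i => by
      by_cases hi : i = v
      · simpa [hi] using (ha v).trans hx.1
      · simpa [Function.update_of_ne hi] using ha i)
    (fun i => by
      by_cases hi : i = v
      · simpa [hi] using hx.2.trans (hb v)
      · simpa [Function.update_of_ne hi] using hb i)
    (fun l u hl hlu hu => by
      have hle := hH l u hl hlu hu
      by_cases hxlu : l ≤ x ∧ x ≤ u
      · have hsub : (Finset.univ.filter fun i =>
            l ≤ Function.update lo v x i ∧ Function.update hi v x i ≤ u) ⊆
            insert v (Finset.univ.filter fun i => l ≤ lo i ∧ hi i ≤ u) := by
          intro i hi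
          by_cases hiv : i = v
          · simp [hiv]
          · simpa [Function.update_of_ne hiv, hiv] using hi
        have hcard := Finset.card_le_card hsub
        by_cases hvlu : l ≤ lo v ∧ hi v ≤ u
        · rw [Finset.insert_eq_of_mem (by simpa using hvlu)] at hcard
          exact hcard.trans hle
        · have hne : ¬ (Finset.univ.filter fun i => l ≤ lo i ∧ hi i ≤ u).card = u + 1 - l :=
            fun he => hvlu (hv l u hl hlu hu he hxlu.1 hxlu.2)
          have := Finset.card_insert_le v (Finset.univ.filter fun i => l ≤ lo i ∧ hi i ≤ u)
          omega
      · refine (Finset.card_le_card fun i hi => ?_).trans hle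
        by_cases hiv : i = v
        · subst hiv
          exact absurd (by simpa using hi) hxlu
        · simpa [Function.update_of_ne hiv] using hi)
  have hfv := hm v
  simp only [Function.update_self] at hfv
  refine ⟨f, hf, by omega, fun i => ?_⟩
  by_cases hiv : i = v
  · subst hiv
    omega
  · simpa [Function.update_of_ne hiv] using hm i

end Hall

/-! ### Propagation rules of the completion -/

section Derivations

variable {A : Type}

theorem Lit.lift_injective : Function.Injective (Lit.lift (A := A)) := by
  rintro ⟨s, a⟩ ⟨s', a'⟩ h
  simpa [Lit.lift] using h

variable [DecidableEq A] {P : Program A} {ds : List (Lit (Var A))}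

theorem Derives.not_of_neg (hf : ¬ Fails P ds) {x : Lit (Var A)} (h : Derives P ds x) :
    ¬ Derives P ds x.neg := fun h' => hf ⟨x, h, h'⟩

theorem Derives.integrity {r : Rule A} (hr : r ∈ P) (hb : r.head = .bot) :
    Derives P ds ⟨false, .body r.body⟩ := by
  have hg : (⟨⟨true, .body r.body⟩, 0, []⟩ : NogoodGroup (Var A)) ∈ P.groups :=
    Program.mem_groups.2 (.inr (.inr (List.mem_map.2 ⟨r, by simp [hr, hb], rfl⟩)))
  exact UP.trigger_neg (G := P.groups) hg (I := ∅) (by simp) (by simp) (by simp)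

/-- A body is derived when enough of its literals are. -/
theorem Derives.body_true {β : Body A} (hβ : β ∈ P.bodies) {W : Finset (Lit A)}
    (hW : ∀ x ∈ W, x ∈ β.lits) (hc : β.bound ≤ W.card) (h : ∀ x ∈ W, Derives P ds x.lift) :
    Derives P ds ⟨true, .body β⟩ := by
  have hg : (⟨⟨false, .body β⟩, β.bound, β.lits.map Lit.lift⟩ : NogoodGroup (Var A)) ∈ P.groups :=
    Program.mem_groups.2 (.inl ⟨β, hβ, by simp [bodyGroups]⟩)
  refine UP.trigger_neg (G := P.groups) hg (I := W.image Lit.lift) ?_ ?_ ?_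
  · intro y hy
    obtain ⟨x, hx, rfl⟩ := Finset.mem_image.1 hy
    exact List.mem_toFinset.2 (List.mem_map_of_mem (hW x hx))
  · rwa [Finset.card_image_of_injective _ Lit.lift_injective]
  · intro y hy
    obtain ⟨x, hx, rfl⟩ := Finset.mem_image.1 hy
    exact h x hx

/-- If a body is false and one literal short of its bound, its other literals are false. -/
theorem Derives.lit_false {β : Body A} (hβ : β ∈ P.bodies)
    (hF : Derives P ds ⟨false, .body β⟩) {W : Finset (Lit A)} (hW : ∀ x ∈ W, x ∈ β.lits)
    (hc : β.bound = W.card + 1) (h : ∀ x ∈ W, Derives P ds x.lift) {x : Lit A} (hx : x ∈ β.lits)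
    (hxW : x ∉ W) : Derives P ds x.lift.neg := by
  have hg : (⟨⟨false, .body β⟩, β.bound, β.lits.map Lit.lift⟩ : NogoodGroup (Var A)) ∈ P.groups :=
    Program.mem_groups.2 (.inl ⟨β, hβ, by simp [bodyGroups]⟩)
  refine UP.lit_neg (G := P.groups) hg hF (I := W.image Lit.lift) ?_ ?_ ?_ ?_ ?_
  · intro y hy
    obtain ⟨x, hx, rfl⟩ := Finset.mem_image.1 hy
    exact List.mem_toFinset.2 (List.mem_map_of_mem (hW x hx))
  · rwa [Finset.card_image_of_injective _ Lit.lift_injective]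
  · intro y hy
    obtain ⟨x, hx, rfl⟩ := Finset.mem_image.1 hy
    exact h x hx
  · exact List.mem_map_of_mem hx
  · intro hm
    obtain ⟨y, hy, he⟩ := Finset.mem_image.1 hm
    exact hxW (Lit.lift_injective he ▸ hy)

theorem Derives.conj_true {L : List (Lit A)} (hβ : Body.conj L ∈ P.bodies)
    (h : ∀ x ∈ L, Derives P ds x.lift) : Derives P ds ⟨true, .body (.conj L)⟩ :=
  .body_true hβ (W := L.toFinset) (by simp [Body.conj])
    (by simp [Body.conj, List.card_toFinset]) (by simpa using h)

theorem Derives.conj_lit_false {L : List (Lit A)} (hβ : Body.conj L ∈ P.bodies)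
    (hF : Derives P ds ⟨false, .body (.conj L)⟩) {x : Lit A} (hx : x ∈ L)
    (h : ∀ y ∈ L, y ≠ x → Derives P ds y.lift) : Derives P ds x.lift.neg := by
  have hxL := List.mem_toFinset.2 hx
  refine .lit_false hβ hF (W := L.toFinset.erase x) ?_ ?_ ?_ ?_ (Finset.notMem_erase _ _)
  · intro y hy
    simpa [Body.conj] using Finset.mem_of_mem_erase hy
  · have := Finset.card_pos.2 ⟨x, hxL⟩
    rw [Finset.card_erase_of_mem hxL]
    have : (Body.conj L).bound = L.toFinset.card := by simp [Body.conj, List.card_toFinset]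
    omega
  · intro y hy
    exact h y (by simpa using Finset.mem_of_mem_erase hy) (Finset.ne_of_mem_erase hy)
  · simpa [Body.conj] using hx

theorem Derives.conj_lit {L : List (Lit A)} (hβ : Body.conj L ∈ P.bodies)
    (hT : Derives P ds ⟨true, .body (.conj L)⟩) {x : Lit A} (hx : x ∈ L) :
    Derives P ds x.lift := by
  have hg : (⟨⟨true, .body (.conj L)⟩, (Body.conj L).lits.length + 1 - (Body.conj L).bound,
      (Body.conj L).lits.map fun x => x.lift.neg⟩ : NogoodGroup (Var A)) ∈ P.groups :=
    Program.mem_groups.2 (.inl ⟨_, hβ, by simp [bodyGroups]⟩)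
  have := UP.lit_neg (G := P.groups) hg hT (I := ∅) (by simp) (by simp [Body.conj]) (by simp)
    (x := x.lift.neg) (List.mem_map.2 ⟨x, by simpa [Body.conj] using hx, rfl⟩) (by simp)
  rwa [Lit.neg_neg] at this

theorem Program.head_mem_atoms {r : Rule A} (hr : r ∈ P) {a : A} (ha : r.head = .atom a) :
    a ∈ P.atoms :=
  Program.mem_atoms.2 ⟨r, hr, .inl (by simp [ha, Head.atoms])⟩

theorem Derives.head_true {r : Rule A} (hr : r ∈ P) {a : A} (ha : r.head = .atom a)
    (h : Derives P ds ⟨true, .body r.body⟩) : Derives P ds ⟨true, .atom a⟩ := by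
  have hg : (⟨⟨false, .atom a⟩, 1, (P.forcing a).map fun β => ⟨true, .body β⟩⟩ :
      NogoodGroup (Var A)) ∈ P.groups :=
    Program.mem_groups.2 (.inr (.inl ⟨a, Program.head_mem_atoms hr ha, by simp [atomGroups]⟩))
  refine UP.trigger_neg (G := P.groups) hg (I := {⟨true, .body r.body⟩}) ?_ (by simp) (by simpa)
  simpa using Program.mem_forcing.2 ⟨r, hr, ha, rfl⟩

theorem Derives.body_false {r : Rule A} (hr : r ∈ P) {a : A} (ha : r.head = .atom a)
    (h : Derives P ds ⟨false, .atom a⟩) : Derives P ds ⟨false, .body r.body⟩ := by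
  have hg : (⟨⟨false, .atom a⟩, 1, (P.forcing a).map fun β => ⟨true, .body β⟩⟩ :
      NogoodGroup (Var A)) ∈ P.groups :=
    Program.mem_groups.2 (.inr (.inl ⟨a, Program.head_mem_atoms hr ha, by simp [atomGroups]⟩))
  refine UP.lit_neg (G := P.groups) hg h (I := ∅) (by simp) (by simp) (by simp)
    (x := ⟨true, .body r.body⟩) ?_ (by simp)
  simpa using Program.mem_forcing.2 ⟨r, hr, ha, rfl⟩

theorem Derives.atom_false {a : A} (ha : a ∈ P.atoms) (h : ∀ r ∈ P, a ∉ r.head.atoms) :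
    Derives P ds ⟨false, .atom a⟩ := by
  have hg : (⟨⟨true, .atom a⟩, (P.supports a).length,
      (P.supports a).map fun β => ⟨false, .body β⟩⟩ : NogoodGroup (Var A)) ∈ P.groups :=
    Program.mem_groups.2 (.inr (.inl ⟨a, ha, by simp [atomGroups]⟩))
  have he : P.supports a = [] := List.eq_nil_iff_forall_not_mem.2 fun β hβ => by
    obtain ⟨r, hr, har, -⟩ := Program.mem_supports.1 hβ
    exact h r hr har
  exact UP.trigger_neg (G := P.groups) hg (I := ∅) (by simp) (by simp [he]) (by simp)

/-- A true atom with a single supporting body makes that body true. -/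
theorem Derives.support_true {r : Rule A} (hr : r ∈ P) {a : A} (ha : a ∈ r.head.atoms)
    (huniq : ∀ r' ∈ P, a ∈ r'.head.atoms → r'.body = r.body)
    (h : Derives P ds ⟨true, .atom a⟩) : Derives P ds ⟨true, .body r.body⟩ := by
  have hg : (⟨⟨true, .atom a⟩, (P.supports a).length,
      (P.supports a).map fun β => ⟨false, .body β⟩⟩ : NogoodGroup (Var A)) ∈ P.groups :=
    Program.mem_groups.2 (.inr (.inl ⟨a, Program.mem_atoms.2 ⟨r, hr, .inl ha⟩,
      by simp [atomGroups]⟩))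
  have hmem : r.body ∈ P.supports a := Program.mem_supports.2 ⟨r, hr, ha, rfl⟩
  have hlen : (P.supports a).length = 1 := by
    have hnd : (P.supports a).Nodup := List.nodup_dedup _
    have hset : (P.supports a).toFinset = {r.body} := by
      ext β
      simp only [List.mem_toFinset, Finset.mem_singleton]
      refine ⟨fun hβ => ?_, fun hβ => hβ ▸ hmem⟩
      obtain ⟨r', hr', har', rfl⟩ := Program.mem_supports.1 hβ
      exact huniq r' hr' har'
    rw [← List.toFinset_card_of_nodup hnd, hset, Finset.card_singleton]
  exact UP.lit_neg (G := P.groups) hg h (I := ∅) (by simp) (by simp [hlen]) (by simp)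
    (x := ⟨false, .body r.body⟩) (List.mem_map_of_mem hmem) (by simp)

end Derivations

/-! ### Models of the completion -/

section Models

variable {A : Type} [DecidableEq A] {P : Program A} {ds : List (Lit (Var A))}

/-- The truth value of a solver variable under a truth assignment to the atoms. -/
def evalVar (α : A → Bool) : Var A → Bool
  | .atom a => α a
  | .body β => decide (β.bound ≤ (β.lits.toFinset.filter fun x => α x.var = x.sign).card)

/-- `α` is a model of the Clark completion of `P`. -/
structure IsCompletionModel (P : Program A) (α : A → Bool) : Prop where
  bot : ∀ r ∈ P, r.head = .bot → evalVar α (.body r.body) = false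
  forced : ∀ r ∈ P, ∀ a, r.head = .atom a → evalVar α (.body r.body) = true → α a = true
  supported : ∀ a ∈ P.atoms, α a = true →
    ∃ r ∈ P, a ∈ r.head.atoms ∧ evalVar α (.body r.body) = true

theorem evalVar_conj {α : A → Bool} {L : List (Lit A)} :
    evalVar α (.body (.conj L)) = true ↔ ∀ x ∈ L, α x.var = x.sign := by
  have hl : (Body.conj L).lits.toFinset = L.toFinset := by
    ext; simp [Body.conj]
  have hb : (Body.conj L).bound = L.toFinset.card := by simp [Body.conj, List.card_toFinset]
  simp only [evalVar, decide_eq_true_eq, hl, hb]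
  constructor
  · intro h x hx
    have := Finset.eq_of_subset_of_card_le (Finset.filter_subset _ _) h
    exact (Finset.filter_eq_self.1 this) x (List.mem_toFinset.2 hx)
  · intro h
    rw [Finset.filter_true_of_mem fun x hx => h x (List.mem_toFinset.1 hx)]

theorem IsCompletionModel.not_nogood {α : A → Bool} (h : IsCompletionModel P α)
    {δ : Finset (Lit (Var A))} (hδ : δ ∈ P.nogoods) (hall : ∀ y ∈ δ, evalVar α y.var = y.sign) :
    False := by
  obtain ⟨g, hg, I, hI, hIc, rfl⟩ := hδ
  have ht := hall _ (Finset.mem_insert_self _ _)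
  have hIh : ∀ y ∈ I, evalVar α y.var = y.sign := fun y hy =>
    hall y (Finset.mem_insert_of_mem hy)
  rcases Program.mem_groups.1 hg with ⟨β, hβ, hg⟩ | ⟨a, ha, hg⟩ | hg
  · simp only [bodyGroups, List.mem_cons, List.not_mem_nil, or_false] at hg
    rcases hg with rfl | rfl
    · have hsub : I ⊆ (β.lits.toFinset.filter fun x => α x.var = x.sign).image Lit.lift := by
        intro y hy
        obtain ⟨x, hx, rfl⟩ := List.mem_map.1 (List.mem_toFinset.1 (hI hy))
        exact Finset.mem_image_of_mem _
          (Finset.mem_filter.2 ⟨List.mem_toFinset.2 hx, hIh _ hy⟩)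
      have := (Finset.card_le_card hsub).trans Finset.card_image_le
      simp only [evalVar, decide_eq_false_iff_not] at ht
      dsimp only at hIc
      omega
    · have hsub : I ⊆ (β.lits.toFinset.filter fun x => ¬ α x.var = x.sign).image
          fun x => x.lift.neg := by
        intro y hy
        obtain ⟨x, hx, rfl⟩ := List.mem_map.1 (List.mem_toFinset.1 (hI hy))
        refine Finset.mem_image_of_mem _ (Finset.mem_filter.2 ⟨List.mem_toFinset.2 hx, ?_⟩)
        have : α x.var = !x.sign := hIh _ hy
        simp [this]
      have h1 := (Finset.card_le_card hsub).trans Finset.card_image_le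
      have h2 := Finset.card_filter_add_card_filter_not (s := β.lits.toFinset)
        (fun x => α x.var = x.sign)
      have h3 := List.toFinset_card_le β.lits
      simp only [evalVar, decide_eq_true_eq] at ht
      dsimp only at hIc
      omega
  · simp only [atomGroups, List.mem_cons, List.not_mem_nil, or_false] at hg
    rcases hg with rfl | rfl
    · obtain ⟨y, hy⟩ := Finset.card_pos.1 (hIc.symm ▸ Nat.one_pos : 0 < I.card)
      obtain ⟨β, hβ, rfl⟩ := List.mem_map.1 (List.mem_toFinset.1 (hI hy))
      obtain ⟨r, hr, hra, rfl⟩ := Program.mem_forcing.1 hβ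
      have := h.forced r hr a hra (hIh _ hy)
      exact absurd (this.symm.trans ht) (by simp)
    · obtain ⟨r, hr, hra, hrb⟩ := h.supported a ha ht
      have hmem : (⟨false, .body r.body⟩ : Lit (Var A)) ∈ I := by
        rw [Finset.eq_of_subset_of_card_le hI
          ((List.toFinset_card_le _).trans (by simp [hIc]))]
        exact List.mem_toFinset.2
          (List.mem_map_of_mem (Program.mem_supports.2 ⟨r, hr, hra, rfl⟩))
      exact absurd ((hIh _ hmem).symm.trans hrb) (by simp)
  · obtain ⟨r, hr, rfl⟩ := List.mem_map.1 hg
    obtain ⟨hr, hb⟩ := List.mem_filter.1 hr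
    exact absurd (ht.symm.trans (h.bot r hr (of_decide_eq_true hb))) (by simp)

/-- Whatever is derived holds in every model of the completion that agrees with the decisions. -/
theorem IsCompletionModel.eval_of_derives {α : A → Bool} (h : IsCompletionModel P α)
    (hds : ∀ x ∈ ds, evalVar α x.var = x.sign) {x : Lit (Var A)} (hx : Derives P ds x) :
    evalVar α x.var = x.sign := by
  induction hx with
  | given x hx => exact hds x hx
  | unit δ x hδ _ _ ih =>
    by_contra hne
    refine h.not_nogood hδ fun y hy => ?_
    by_cases hyx : y = x.neg
    · subst hyx
      exact Bool.eq_not_of_ne hne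
    · exact ih y hy hyx

theorem IsCompletionModel.not_fails {α : A → Bool} (h : IsCompletionModel P α)
    (hds : ∀ x ∈ ds, evalVar α x.var = x.sign) : ¬ Fails P ds := by
  rintro ⟨x, h1, h2⟩
  have e1 := h.eval_of_derives hds h1
  have e2 : evalVar α x.var = !x.sign := h.eval_of_derives hds h2
  rw [e1] at e2
  simp at e2

theorem IsBranch.var_mem (h : IsBranch P ds) {x : Lit (Var A)} (hx : x ∈ ds) :
    x.var ∈ P.vars := by
  induction h with
  | root => simp at hx
  | decide ds y _ _ hy _ ih =>
    rcases List.mem_append.1 hx with hx | hx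
    · exact ih hx
    · exact List.mem_singleton.1 hx ▸ hy

end Models

/-! ### The rules of the encoding -/

section Encoding

variable {n d : ℕ}

theorem mem_intervals {I : ℕ × ℕ} : I ∈ intervals d ↔ 1 ≤ I.1 ∧ I.1 ≤ I.2 ∧ I.2 ≤ d := by
  obtain ⟨l, u⟩ := I
  simp only [intervals, List.mem_flatMap, List.mem_map, List.mem_range'_1, Prod.mk.injEq]
  constructor
  · rintro ⟨l', h1, u', h2, rfl, rfl⟩
    omega
  · intro h
    exact ⟨l, by omega, u, by omega, rfl, rfl⟩

theorem mem_encoding {r : Rule (Atom n)} : r ∈ encoding n d ↔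
    r = ⟨.atom .sat, .conj [naf .violate]⟩ ∨ r = ⟨.atom .violate, .conj [naf .sat]⟩ ∨
    (∃ l u, (1 ≤ l ∧ l ≤ u ∧ u ≤ d) ∧ r = ⟨.atom .violate,
      .card (u - l + 2) ((List.finRange n).map fun v => pos (.r v l u))⟩) ∨
    (∃ v, r = ⟨.choice ((List.range' 1 d).map fun i => .b v i), .conj []⟩) ∨
    (∃ v i, (1 ≤ i ∧ i < d) ∧ r = ⟨.bot, .conj [pos (.b v i), naf (.b v (i + 1))]⟩) ∨
    (∃ v, r = ⟨.bot, .conj [naf (.b v d)]⟩) ∨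
    (∃ v l u, (1 ≤ l ∧ l ≤ u ∧ u ≤ d) ∧
      (r = ⟨.atom (.r v l u), .conj [naf (.b v (l - 1)), pos (.b v u)]⟩ ∨
       r = ⟨.bot, .conj [pos (.r v l u), pos (.b v (l - 1))]⟩ ∨
       r = ⟨.bot, .conj [pos (.r v l u), naf (.b v u)]⟩)) := by
  have hb : r ∈ boundRules n d ↔
      (∃ v, r = ⟨.choice ((List.range' 1 d).map fun i => .b v i), .conj []⟩) ∨
      (∃ v i, (1 ≤ i ∧ i < d) ∧ r = ⟨.bot, .conj [pos (.b v i), naf (.b v (i + 1))]⟩) ∨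
      (∃ v, r = ⟨.bot, .conj [naf (.b v d)]⟩) := by
    have hi : ∀ i, (1 ≤ i ∧ i < 1 + (d - 1)) ↔ (1 ≤ i ∧ i < d) := by intro i; omega
    simp only [boundRules, List.mem_flatMap, List.mem_finRange, true_and, List.mem_append,
      List.mem_singleton, List.mem_map, List.mem_range'_1, exists_or, hi, or_assoc, eq_comm]
  simp only [encoding, List.mem_append, reifyRules, List.mem_cons, List.not_mem_nil, or_false,
    hallRules, List.mem_map, hb, linkRules, List.mem_flatMap, List.mem_finRange, true_and,
    mem_intervals, Prod.exists, or_assoc, eq_comm]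

theorem head_cases {r : Rule (Atom n)} (hr : r ∈ encoding n d) {a : Atom n}
    (ha : a ∈ r.head.atoms) :
    (a = .sat ∧ r.body = .conj [naf .violate]) ∨ a = .violate ∨
    (∃ v i, a = .b v i ∧ 1 ≤ i ∧ i ≤ d ∧ r.body = .conj []) ∨ (∃ v l u, a = .r v l u) := by
  rcases mem_encoding.1 hr with rfl | rfl | ⟨l, u, _, rfl⟩ | ⟨v, rfl⟩ | ⟨v, i, _, rfl⟩ | ⟨v, rfl⟩ |
    ⟨v, l, u, _, rfl | rfl | rfl⟩ <;> simp only [Head.atoms, List.mem_cons, List.not_mem_nil,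
      or_false, List.mem_map, List.mem_range'_1] at ha
  · exact .inl ⟨ha, rfl⟩
  · exact .inr (.inl ha)
  · exact .inr (.inl ha)
  · obtain ⟨i, hi, rfl⟩ := ha
    exact .inr (.inr (.inl ⟨v, i, rfl, hi.1, by omega, rfl⟩))
  · exact .inr (.inr (.inr ⟨v, l, u, ha⟩))

theorem atom_b_le {v : Fin n} {i : ℕ} (h : .b v i ∈ (encoding n d).atoms) : i ≤ d := by
  obtain ⟨r, hr, hra | ⟨x, hx, hxa⟩⟩ := Program.mem_atoms.1 h
  · rcases head_cases hr hra with h | h | ⟨v', i', h, _, hi, _⟩ | ⟨_, _, _, h⟩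
    · cases h.1
    · cases h
    · cases h; exact hi
    · cases h
  · rcases mem_encoding.1 hr with rfl | rfl | ⟨l, u, _, rfl⟩ | ⟨v, rfl⟩ | ⟨v, i, _, rfl⟩ | ⟨v, rfl⟩ |
      ⟨v, l, u, _, rfl | rfl | rfl⟩ <;>
    simp only [Body.conj, Body.card, List.mem_dedup, List.mem_cons, List.not_mem_nil, or_false,
      List.mem_map, List.mem_finRange, true_and] at hx <;>
    first
    | (rcases hx with rfl | rfl <;> cases hxa <;> omega)
    | (obtain ⟨w, rfl⟩ := hx; cases hxa)

/-! ### Derivations on the encoding -/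

variable {ds : List (Lit (Var (Atom n)))}

theorem b_zero_mem_atoms (hd : 1 ≤ d) (v : Fin n) : .b v 0 ∈ (encoding n d).atoms := by
  refine Program.mem_atoms.2 ⟨⟨.atom (.r v 1 1), .conj [naf (.b v (1 - 1)), pos (.b v 1)]⟩, ?_,
    .inr ⟨naf (.b v 0), ?_, rfl⟩⟩
  · simp only [mem_encoding]
    iterate 6 right
    exact ⟨v, 1, 1, by omega, .inl rfl⟩
  · simp [Body.conj]

/-- `b(v,0)` has no supporting rule. -/
theorem b_zero_false (hd : 1 ≤ d) (v : Fin n) :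
    Derives (encoding n d) ds (atomLit false (.b v 0)) := by
  refine .atom_false (b_zero_mem_atoms hd v) fun r hr ha => ?_
  rcases head_cases hr ha with h | h | ⟨v', i', h, hi, _⟩ | ⟨_, _, _, h⟩
  · cases h.1
  · cases h
  · cases h; omega
  · cases h

theorem b_last_true (v : Fin n) : Derives (encoding n d) ds (atomLit true (.b v d)) := by
  have hr : ⟨.bot, .conj [naf (.b v d)]⟩ ∈ encoding n d := by
    simp only [mem_encoding]
    iterate 5 right
    exact .inl ⟨v, rfl⟩
  exact Derives.conj_lit_false (Program.body_mem_bodies hr) (.integrity hr rfl)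
    (x := naf (.b v d)) (by simp) (by simp)

theorem b_succ_rule (v : Fin n) {i : ℕ} (h1 : 1 ≤ i) (h2 : i < d) :
    ⟨.bot, .conj [pos (.b v i), naf (.b v (i + 1))]⟩ ∈ encoding n d := by
  simp only [mem_encoding]
  iterate 4 right
  exact .inl ⟨v, i, ⟨h1, h2⟩, rfl⟩

theorem b_true_mono (hf : ¬ Fails (encoding n d) ds) (hd : 1 ≤ d) (v : Fin n) {i j : ℕ}
    (hij : i ≤ j) (hj : j ≤ d) (h : Derives (encoding n d) ds (atomLit true (.b v i))) :
    Derives (encoding n d) ds (atomLit true (.b v j)) := by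
  induction j, hij using Nat.le_induction with
  | base => exact h
  | succ j hij ih =>
    have hi0 : i ≠ 0 := by
      rintro rfl
      exact h.not_of_neg hf (b_zero_false hd v)
    have hr := b_succ_rule v (show 1 ≤ j by omega) (show j < d by omega)
    refine Derives.conj_lit_false (Program.body_mem_bodies hr) (.integrity hr rfl)
      (x := naf (.b v (j + 1))) (by simp) fun y hy hne => ?_
    simp only [List.mem_cons, List.not_mem_nil, or_false] at hy
    rcases hy with rfl | rfl
    · exact ih (by omega)
    · exact absurd rfl hne

theorem b_false_mono (hd : 1 ≤ d) (v : Fin n) {i j : ℕ}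
    (hij : i ≤ j) (hj : j ≤ d) (h : Derives (encoding n d) ds (atomLit false (.b v j))) :
    Derives (encoding n d) ds (atomLit false (.b v i)) := by
  induction j, hij using Nat.le_induction with
  | base => exact h
  | succ j hij ih =>
    rcases Nat.eq_zero_or_pos j with hj0 | hj0
    · rw [show i = 0 by omega]
      exact b_zero_false hd v
    have hr := b_succ_rule v hj0 (show j < d by omega)
    refine ih (by omega) (Derives.conj_lit_false (Program.body_mem_bodies hr) (.integrity hr rfl)
      (x := pos (.b v j)) (by simp) fun y hy hne => ?_)
    simp only [List.mem_cons, List.not_mem_nil, or_false] at hy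
    rcases hy with rfl | rfl
    · exact absurd rfl hne
    · exact h

/-- The bounds on `v` that have been derived. -/
theorem exists_derived_bounds (hf : ¬ Fails (encoding n d) ds) (hd : 1 ≤ d) (v : Fin n) :
    ∃ lo hi, 1 ≤ lo ∧ lo ≤ hi ∧ hi ≤ d ∧
      (∀ i ≤ d, Derives (encoding n d) ds (atomLit false (.b v i)) ↔ i < lo) ∧
      (∀ i ≤ d, Derives (encoding n d) ds (atomLit true (.b v i)) ↔ hi ≤ i) := by
  classical
  have hlast := b_last_true (d := d) (ds := ds) v
  have hex : ∃ i, ¬ Derives (encoding n d) ds (atomLit false (.b v i)) :=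
    ⟨d, hlast.not_of_neg hf⟩
  have hex' : ∃ i, Derives (encoding n d) ds (atomLit true (.b v i)) := ⟨d, hlast⟩
  have hhi := Nat.find_min' hex' hlast
  refine ⟨Nat.find hex, Nat.find hex', ?_, ?_, hhi, ?_, ?_⟩
  · rw [Nat.one_le_iff_ne_zero]
    exact fun h0 => (h0 ▸ Nat.find_spec hex) (b_zero_false hd v)
  · exact Nat.find_min' hex ((Nat.find_spec hex').not_of_neg hf)
  · intro i hi
    refine ⟨fun h => ?_, fun h => not_not.1 (Nat.find_min hex h)⟩
    by_contra hle
    exact Nat.find_spec hex (b_false_mono hd v (not_lt.1 hle) hi h)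
  · intro i hi
    exact ⟨fun h => Nat.find_min' hex' h,
      fun h => b_true_mono hf hd v h hi (Nat.find_spec hex')⟩

/-- The domain of `v` is the interval between the derived bounds. -/
theorem domainAt_eq_Icc {v : Fin n} {lo hi : ℕ} (h1 : 1 ≤ lo) (h2 : hi ≤ d)
    (hF : ∀ i ≤ d, Derives (encoding n d) ds (atomLit false (.b v i)) ↔ i < lo)
    (hT : ∀ i ≤ d, Derives (encoding n d) ds (atomLit true (.b v i)) ↔ hi ≤ i) :
    domainAt n d ds v = Set.Icc lo hi := by
  ext i
  simp only [domainAt, Set.mem_ofPred_eq, Set.mem_Icc]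
  constructor
  · rintro ⟨h3, h4, h5, h6⟩
    rw [hF i h4] at h5
    rw [hT _ (by omega)] at h6
    omega
  · rintro ⟨h3, h4⟩
    rw [hF i (by omega), hT _ (by omega)]
    omega

/-- `sat` has a single supporting body, `not violate`. -/
theorem violate_false (h : Derives (encoding n d) ds (atomLit true .sat)) :
    Derives (encoding n d) ds (atomLit false .violate) := by
  have hr : ⟨.atom .sat, .conj [naf .violate]⟩ ∈ encoding n d := mem_encoding.2 (.inl rfl)
  have hb := h.support_true hr (by simp [Head.atoms]) fun r' hr' ha => by
    rcases head_cases hr' ha with h | h | ⟨_, _, h, _⟩ | ⟨_, _, _, h⟩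
    · exact h.2
    · cases h
    · cases h
    · cases h
  exact Derives.conj_lit (Program.body_mem_bodies hr) hb (x := naf .violate) (by simp)

theorem hall_rule {l u : ℕ} (h : 1 ≤ l ∧ l ≤ u ∧ u ≤ d) :
    ⟨.atom .violate, .card (u - l + 2) ((List.finRange n).map fun v => pos (.r v l u))⟩ ∈
      encoding n d := by
  simp only [mem_encoding]
  iterate 2 right
  exact .inl ⟨l, u, h, rfl⟩

theorem link_rule (v : Fin n) {l u : ℕ} (h : 1 ≤ l ∧ l ≤ u ∧ u ≤ d) :
    ⟨.atom (.r v l u), .conj [naf (.b v (l - 1)), pos (.b v u)]⟩ ∈ encoding n d := by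
  simp only [mem_encoding]
  iterate 6 right
  exact ⟨v, l, u, h, .inl rfl⟩

theorem r_true {v : Fin n} {l u : ℕ} (h : 1 ≤ l ∧ l ≤ u ∧ u ≤ d)
    (hF : Derives (encoding n d) ds (atomLit false (.b v (l - 1))))
    (hT : Derives (encoding n d) ds (atomLit true (.b v u))) :
    Derives (encoding n d) ds (atomLit true (.r v l u)) := by
  have hr := link_rule v h
  refine Derives.head_true hr rfl (.conj_true (Program.body_mem_bodies hr) ?_)
  intro x hx
  simp only [List.mem_cons, List.not_mem_nil, or_false] at hx
  rcases hx with rfl | rfl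
  · exact hF
  · exact hT

theorem b_false_of_r_false {v : Fin n} {l u : ℕ} (h : 1 ≤ l ∧ l ≤ u ∧ u ≤ d)
    (hR : Derives (encoding n d) ds (atomLit false (.r v l u)))
    (hF : Derives (encoding n d) ds (atomLit false (.b v (l - 1)))) :
    Derives (encoding n d) ds (atomLit false (.b v u)) := by
  have hr := link_rule v h
  refine Derives.conj_lit_false (Program.body_mem_bodies hr) (.body_false hr rfl hR)
    (x := pos (.b v u)) (by simp) fun y hy hne => ?_
  simp only [List.mem_cons, List.not_mem_nil, or_false] at hy
  rcases hy with rfl | rfl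
  · exact hF
  · exact absurd rfl hne

theorem b_true_of_r_false {v : Fin n} {l u : ℕ} (h : 1 ≤ l ∧ l ≤ u ∧ u ≤ d)
    (hR : Derives (encoding n d) ds (atomLit false (.r v l u)))
    (hT : Derives (encoding n d) ds (atomLit true (.b v u))) :
    Derives (encoding n d) ds (atomLit true (.b v (l - 1))) := by
  have hr := link_rule v h
  refine Derives.conj_lit_false (Program.body_mem_bodies hr) (.body_false hr rfl hR)
    (x := naf (.b v (l - 1))) (by simp) fun y hy hne => ?_
  simp only [List.mem_cons, List.not_mem_nil, or_false] at hy
  rcases hy with rfl | rfl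
  · exact absurd rfl hne
  · exact hT

section Hall

variable {l u : ℕ} {W : Finset (Fin n)}

theorem r_injective (l u : ℕ) : Function.Injective fun v : Fin n => pos (Atom.r v l u) := by
  intro v w h
  simpa using h

theorem mem_hall_lits {k : ℕ} (v : Fin n) : pos (Atom.r v l u) ∈
    (Body.card k ((List.finRange n).map fun v => pos (Atom.r v l u))).lits := by
  simp [Body.card]

/-- No interval contains more domains than it has values. -/
theorem card_le_of_r_true (hf : ¬ Fails (encoding n d) ds)
    (hs : Derives (encoding n d) ds (atomLit true .sat)) (h : 1 ≤ l ∧ l ≤ u ∧ u ≤ d)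
    (hW : ∀ w ∈ W, Derives (encoding n d) ds (atomLit true (.r w l u))) :
    W.card ≤ u + 1 - l := by
  by_contra hlt
  have hr := hall_rule (n := n) h
  have hb : Derives (encoding n d) ds ⟨true, .body (.card (u - l + 2)
      ((List.finRange n).map fun v => pos (.r v l u)))⟩ := by
    refine .body_true (Program.body_mem_bodies hr)
      (W := W.image fun v => pos (.r v l u)) ?_ ?_ ?_
    · intro x hx
      obtain ⟨v, -, rfl⟩ := Finset.mem_image.1 hx
      exact mem_hall_lits v
    · rw [Finset.card_image_of_injective _ (r_injective l u)]
      show u - l + 2 ≤ W.card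
      omega
    · intro x hx
      obtain ⟨v, hv, rfl⟩ := Finset.mem_image.1 hx
      exact hW v hv
  exact hb.not_of_neg hf (.body_false hr rfl (violate_false hs))

/-- If an interval contains as many domains as it has values, it can hold no other variable. -/
theorem r_false_of_card_eq (hs : Derives (encoding n d) ds (atomLit true .sat))
    (h : 1 ≤ l ∧ l ≤ u ∧ u ≤ d)
    (hW : ∀ w ∈ W, Derives (encoding n d) ds (atomLit true (.r w l u)))
    (hc : W.card = u + 1 - l) {v : Fin n} (hv : v ∉ W) :
    Derives (encoding n d) ds (atomLit false (.r v l u)) := by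
  have hr := hall_rule (n := n) h
  refine Derives.lit_false (Program.body_mem_bodies hr)
    (.body_false hr rfl (violate_false hs)) (W := W.image fun v => pos (.r v l u)) ?_ ?_ ?_
    (mem_hall_lits v) ?_
  · intro x hx
    obtain ⟨v, -, rfl⟩ := Finset.mem_image.1 hx
    exact mem_hall_lits v
  · rw [Finset.card_image_of_injective _ (r_injective l u)]
    show u - l + 2 = W.card + 1
    omega
  · intro x hx
    obtain ⟨v, hv, rfl⟩ := Finset.mem_image.1 hx
    exact hW v hv
  · intro hx
    obtain ⟨w, hw, he⟩ := Finset.mem_image.1 hx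
    exact hv (r_injective l u he ▸ hw)

end Hall

/-- Where all-different is posted and propagation does not fail, it is bound consistent. -/
theorem boundConsistent_domainAt (hd : 1 ≤ d) (hf : ¬ Fails (encoding n d) ds)
    (hs : Derives (encoding n d) ds (atomLit true .sat)) :
    (∀ v, ∃ lo hi, lo ≤ hi ∧ domainAt n d ds v = Set.Icc lo hi) ∧
      BoundConsistent (allDifferent n) (domainAt n d ds) := by
  choose lo hi h1 hle h2 hF hT using exists_derived_bounds hf hd
  have hD : ∀ v, domainAt n d ds v = Set.Icc (lo v) (hi v) := fun v =>
    domainAt_eq_Icc (h1 v) (h2 v) (hF v) (hT v)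
  refine ⟨fun v => ⟨lo v, hi v, hle v, hD v⟩, ?_⟩
  intro v i hvi
  have hi' : i = lo v ∨ i = hi v := by
    rw [hD] at hvi
    exact hvi.imp (fun h => h.unique (isLeast_Icc (hle v)))
      fun h => h.unique (isGreatest_Icc (hle v))
  have hr : ∀ l u, 1 ≤ l → l ≤ u → u ≤ d →
      ∀ w ∈ (Finset.univ.filter fun w => l ≤ lo w ∧ hi w ≤ u),
      Derives (encoding n d) ds (atomLit true (.r w l u)) := by
    intro l u hl hlu hu w hw
    obtain ⟨-, hw1, hw2⟩ := Finset.mem_filter.1 hw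
    exact r_true ⟨hl, hlu, hu⟩ ((hF w _ (by omega)).2 (by omega)) ((hT w u hu).2 hw2)
  have hH : ∀ l u, 1 ≤ l → l ≤ u → u ≤ d →
      (Finset.univ.filter fun w => l ≤ lo w ∧ hi w ≤ u).card ≤ u + 1 - l :=
    fun l u hl hlu hu => card_le_of_r_true hf hs ⟨hl, hlu, hu⟩ (hr l u hl hlu hu)
  have hvle := hle v
  obtain ⟨f, hfi, hfv, hfm⟩ := exists_support_of_card_le hle h1 h2 hH v (x := i) (by omega) <| by
    intro l u hl hlu hu hc hil hiu
    by_contra hvm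
    have hrF := r_false_of_card_eq hs ⟨hl, hlu, hu⟩ (hr l u hl hlu hu) hc (v := v)
      (by simpa using hvm)
    rcases hi' with rfl | rfl
    · have := b_false_of_r_false ⟨hl, hlu, hu⟩ hrF ((hF v _ (by omega)).2 (by omega))
      rw [hF v u hu] at this
      omega
    · have := b_true_of_r_false ⟨hl, hlu, hu⟩ hrF ((hT v u hu).2 hiu)
      rw [hT v _ (by omega)] at this
      omega
  refine ⟨f, hfi, hfv, fun w _ => ⟨lo w, hi w, ?_, ?_, hfm w⟩⟩
  · rw [hD]; exact isLeast_Icc (hle w)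
  · rw [hD]; exact isGreatest_Icc (hle w)

/-! ### Solutions as models of the encoding -/

/-- The truth assignment to the atoms that describes the assignment `f` to the variables.  Ranges
outside `[1, d]` have no rules, so their atoms are false. -/
def solutionAtoms (d : ℕ) (f : Fin n → ℕ) : Atom n → Bool
  | .b v i => decide (f v ≤ i)
  | .r v l u => decide (1 ≤ l ∧ l ≤ f v ∧ f v ≤ u ∧ u ≤ d)
  | .sat => true
  | .violate => false

theorem isCompletionModel_solutionAtoms {f : Fin n → ℕ} (hf : Function.Injective f)
    (h1 : ∀ v, 1 ≤ f v) (h2 : ∀ v, f v ≤ d) :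
    IsCompletionModel (encoding n d) (solutionAtoms d f) where
  bot r hr hb := by
    rw [← Bool.not_eq_true]
    rcases mem_encoding.1 hr with rfl | rfl | ⟨l, u, _, rfl⟩ | ⟨v, rfl⟩ | ⟨v, i, _, rfl⟩ | ⟨v, rfl⟩ |
      ⟨v, l, u, _, rfl | rfl | rfl⟩ <;> simp at hb <;> rw [evalVar_conj] <;>
      simp [solutionAtoms]
    · omega
    · exact h2 v
    · omega
    · omega
  forced r hr a ha hb := by
    rcases mem_encoding.1 hr with rfl | rfl | ⟨l, u, hlu, rfl⟩ | ⟨v, rfl⟩ | ⟨v, i, _, rfl⟩ |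
      ⟨v, rfl⟩ | ⟨v, l, u, _, rfl | rfl | rfl⟩ <;> simp at ha <;> subst ha
    · rfl
    · rw [evalVar_conj] at hb
      simp [solutionAtoms] at hb
    · -- An injective `f` takes at most `u - l + 1` values in `[l, u]`.
      exfalso
      simp only [evalVar, decide_eq_true_eq] at hb
      have hsub : (Body.card (u - l + 2) ((List.finRange n).map
            fun v => pos (Atom.r v l u))).lits.toFinset.filter
            (fun x => solutionAtoms d f x.var = x.sign) ⊆
          (Finset.univ.filter fun v => f v ∈ Finset.Icc l u).image fun v => pos (.r v l u) := by
        intro x hx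
        obtain ⟨hx1, hx2⟩ := Finset.mem_filter.1 hx
        simp only [Body.card, List.mem_toFinset, List.mem_dedup, List.mem_map] at hx1
        obtain ⟨v, -, rfl⟩ := hx1
        simp only [solutionAtoms, decide_eq_true_eq] at hx2
        exact Finset.mem_image_of_mem _ (by simp [hx2])
      have e1 := (Finset.card_le_card hsub).trans Finset.card_image_le
      have e2 : (Finset.univ.filter fun v => f v ∈ Finset.Icc l u).card ≤
          (Finset.Icc l u).card :=
        Finset.card_le_card_of_injOn f (fun v hv => by simpa using hv) hf.injOn
      rw [Nat.card_Icc] at e2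
      have e3 : (Body.card (u - l + 2) ((List.finRange n).map
        fun v => pos (Atom.r v l u))).bound = u - l + 2 := rfl
      omega
    · rw [evalVar_conj] at hb
      simp [solutionAtoms] at hb ⊢
      omega
  supported a ha hat := by
    cases a with
    | b v i =>
      have hi : f v ≤ i := by simpa [solutionAtoms] using hat
      have := h1 v
      refine ⟨⟨.choice ((List.range' 1 d).map fun i => .b v i), .conj []⟩, ?_, ?_, ?_⟩
      · simp only [mem_encoding]
        iterate 3 right
        exact .inl ⟨v, rfl⟩
      · have := atom_b_le ha
        simp only [Head.atoms, List.mem_map, List.mem_range'_1]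
        exact ⟨i, by omega, rfl⟩
      · rw [evalVar_conj]; simp
    | r v l u =>
      have hlu : 1 ≤ l ∧ l ≤ f v ∧ f v ≤ u ∧ u ≤ d := by simpa [solutionAtoms] using hat
      refine ⟨_, link_rule v (l := l) (u := u) (by omega), by simp [Head.atoms], ?_⟩
      rw [evalVar_conj]
      simp [solutionAtoms]
      omega
    | sat =>
      refine ⟨_, mem_encoding.2 (.inl rfl), by simp [Head.atoms], ?_⟩
      rw [evalVar_conj]; simp [solutionAtoms]
    | violate => simp [solutionAtoms] at hat

/-- Derived bounds are respected by every solution within the bounds that were decided, in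
particular by the supports of the least and the greatest element of `E v`. -/
theorem IsConsistentPruning.subset_domainAt
    (hds : ∀ x ∈ ds, x = atomLit true .sat ∨ ∃ sign v i, x = atomLit sign (.b v i))
    {E : Fin n → Set ℕ} (hE : IsConsistentPruning (givenDomain n d ds) E) (v : Fin n) :
    ¬ Fails (encoding n d) ds ∧ E v ⊆ domainAt n d ds v := by
  obtain ⟨hsub, hne, hbc⟩ := hE
  have hmin : ∀ w, ∃ m, IsLeast (E w) m := fun w =>
    ⟨sInf (E w), Nat.sInf_mem (hne w), fun i hi => Nat.sInf_le hi⟩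
  have hmax : ∀ w, ∃ m, IsGreatest (E w) m := fun w =>
    ⟨sSup (E w), Nat.sSup_mem (hne w) ⟨d, fun i hi => (hsub w hi).2.1⟩,
      fun i hi => le_csSup ⟨d, fun i hi => (hsub w hi).2.1⟩ hi⟩
  choose mn hmn using hmin
  choose mx hmx using hmax
  have hle : ∀ w, mn w ≤ mx w := fun w => (hmn w).2 (hmx w).1
  have hmodel : ∀ f ∈ allDifferent n, (∀ w, mn w ≤ f w ∧ f w ≤ mx w) →
      IsCompletionModel (encoding n d) (solutionAtoms d f) ∧
      ∀ x ∈ ds, evalVar (solutionAtoms d f) x.var = x.sign := by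
    intro f hf hfm
    refine ⟨isCompletionModel_solutionAtoms hf (fun w => ?_) (fun w => ?_), fun x hx => ?_⟩
    · exact (hsub w (hmn w).1).1.trans (hfm w).1
    · exact (hfm w).2.trans (hsub w (hmx w).1).2.1
    · rcases hds x hx with rfl | ⟨sign, w, i, rfl⟩
      · rfl
      · cases sign
        · have := (hsub w (hmn w).1).2.2.2 i hx
          have := (hfm w).1
          simp only [evalVar, solutionAtoms, decide_eq_false_iff_not]
          omega
        · have := (hsub w (hmx w).1).2.2.1 i hx
          have := (hfm w).2
          simp only [evalVar, solutionAtoms, decide_eq_true_eq]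
          omega
  have hsupp : ∀ i, IsLeast (E v) i ∨ IsGreatest (E v) i →
      ∃ f ∈ allDifferent n, f v = i ∧ ∀ w, mn w ≤ f w ∧ f w ≤ mx w := by
    intro i hi
    obtain ⟨f, hf, hfv, hfm⟩ := hbc v i hi
    refine ⟨f, hf, hfv, fun w => ?_⟩
    by_cases hw : w = v
    · subst hw
      rw [hfv]
      rcases hi with hi | hi
      · rw [hi.unique (hmn w)]; exact ⟨le_rfl, hle w⟩
      · rw [hi.unique (hmx w)]; exact ⟨hle w, le_rfl⟩
    · obtain ⟨lo, hi, hlo, hhi, h1, h2⟩ := hfm w hw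
      rw [(hmn w).unique hlo, (hmx w).unique hhi]
      exact ⟨h1, h2⟩
  obtain ⟨f, hf, hfv, hfm⟩ := hsupp _ (.inl (hmn v))
  obtain ⟨g, hg, hgv, hgm⟩ := hsupp _ (.inr (hmx v))
  obtain ⟨hf1, hf2⟩ := hmodel f hf hfm
  obtain ⟨hg1, hg2⟩ := hmodel g hg hgm
  refine ⟨hf1.not_fails hf2, fun i hi => ?_⟩
  have hi' := hsub v hi
  have hil := (hmn v).2 hi
  have hiu := (hmx v).2 hi
  refine ⟨hi'.1, hi'.2.1, fun h => ?_, fun h => ?_⟩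
  · have := hf1.eval_of_derives hf2 h
    simp only [evalVar, solutionAtoms, decide_eq_false_iff_not] at this
    omega
  · have := hg1.eval_of_derives hg2 h
    have := hi'.1
    simp only [evalVar, solutionAtoms, decide_eq_true_eq] at *
    omega

theorem domainAt_subset_givenDomain (hd : 1 ≤ d) (hbr : IsBranch (encoding n d) ds)
    (hf : ¬ Fails (encoding n d) ds) (v : Fin n) :
    domainAt n d ds v ⊆ givenDomain n d ds v := by
  rintro i ⟨h1, h2, h3, h4⟩
  refine ⟨h1, h2, fun j hj => ?_, fun j hj => ?_⟩
  · by_contra hij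
    exact h4 (b_true_mono hf hd v (i := j) (by omega) (by omega) (.given _ hj))
  · by_contra hij
    have hjd := atom_b_le (Program.atom_mem_vars.1 (hbr.var_mem hj))
    exact h3 (b_false_mono hd v (not_lt.1 hij) hjd (.given _ hj))

end Encoding

end BoundAllDiff

theorem mainTheorem5 :
    ∃ C : ℕ, ∀ n d : ℕ, 1 ≤ n → 1 ≤ d →
      ∀ ds : List (Lit (Var (Atom n))), IsBranch (encoding n d) ds →
        -- cost: propagation down the branch is done within `C * n * d ^ 2` steps
        (∃ (t : ℕ) (s : State (Var (Atom n))),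
          Run (encoding n d).groups ds t s ∧
          t ≤ C * (n * d ^ 2) ∧
          (s.conflict = true ↔ Fails (encoding n d) ds) ∧
          (¬ Fails (encoding n d) ds → ∀ x, s.Holds x ↔ Derives (encoding n d) ds x)) ∧
        -- consistency: at every node at which all-different is posted and propagation does not
        -- fail, the domains are non-empty intervals on which all-different is bound consistent
        (Derives (encoding n d) ds (atomLit true .sat) → ¬ Fails (encoding n d) ds →
          (∀ v, ∃ lo hi, lo ≤ hi ∧ domainAt n d ds v = Set.Icc lo hi) ∧
          BoundConsistent (allDifferent n) (domainAt n d ds)) ∧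
        -- exactness: if all-different is posted and the decisions are bounds on the variables,
        -- propagation prunes exactly what bound consistency prunes
        (atomLit true .sat ∈ ds →
          (∀ x ∈ ds, x = atomLit true .sat ∨ ∃ sign v i, x = atomLit sign (.b v i)) →
          (Fails (encoding n d) ds ↔ ¬ ∃ E, IsConsistentPruning (givenDomain n d ds) E) ∧
          (¬ Fails (encoding n d) ds →
            IsConsistentPruning (givenDomain n d ds) (domainAt n d ds) ∧
            ∀ E, IsConsistentPruning (givenDomain n d ds) E → ∀ v, E v ⊆ domainAt n d ds v)) := by
  -- The program has length at most `30 n d²`, and propagation takes `42` steps per unit of length.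
  refine ⟨42 * 30 + 2, fun n d hn hd ds hbr => ⟨?_, fun hs hf => boundConsistent_domainAt hd hf hs,
    fun hsat hds => ?_⟩⟩
  · obtain ⟨t, s, hr, ht, hs⟩ := hbr.exists_run_le
    have h1 := length_encoding_le hn hd
    have h2 : 1 ≤ n * d ^ 2 := Nat.mul_pos hn (pow_pos hd 2)
    exact ⟨t, s, hr, by omega, hs⟩
  · have hcons : ¬ Fails (encoding n d) ds →
        IsConsistentPruning (givenDomain n d ds) (domainAt n d ds) := fun hf => by
      obtain ⟨hI, hbc⟩ := boundConsistent_domainAt hd hf (.given _ hsat)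
      refine ⟨domainAt_subset_givenDomain hd hbr hf, fun v => ?_, hbc⟩
      obtain ⟨lo, hi, hle, he⟩ := hI v
      exact he ▸ Set.nonempty_Icc.2 hle
    refine ⟨⟨fun hf ⟨E, hE⟩ => (hE.subset_domainAt hds ⟨0, hn⟩).1 hf, fun h => ?_⟩,
      fun hf => ⟨hcons hf, fun E hE v => (hE.subset_domainAt hds v).2⟩⟩
    by_contra hf
    exact h ⟨_, hcons hf⟩
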